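/- Let $k\ge 0$, $\theta>0$, $\lambda>0$ and $4\le p<6$. Let $H^1(\mathbb R)=W^{1,2}(\mathbb R)$ be the Sobolev space of complex-valued functions, with norm $\|u\|^2=\int_{\mathbb R}(|u'|^2+|u|^2)\,dx$ (derivatives in the weak sense), and put $$I(u)=\int_{\mathbb R}\Big[\tfrac12|u'|^2+\tfrac k4\big|(|u|^2)'\big|^2-\tfrac{\theta}{p}|u|^p\Big]dx,\qquad \mathcal M=\Big\{u\in H^1(\mathbb R):\ \tfrac12\int_{\mathbb R}|u|^2\,dx=\lambda\Big\},\qquad m=\inf_{u\in\mathcal M}I(u).$$ Then: (i) $-\infty<m<0$. (ii) $m$ is attained by a nonnegative function: there is $0\ne w\in\mathcal M$ with $w\ge 0$ and $I(w)=m$. (iii) Every minimizing sequence converges, up to a subsequence and translations: if $u_n\in\mathcal M$ and $I(u_n)\to m$, then there are a subsequence $(u_{n_j})$, points $y_j\in\mathbb R$ and $w\in\mathcal M$ with $I(w)=m$ such that $\|u_{n_j}(\cdot+y_j)-w\|\to 0$ as $j\to\infty$. -/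

import Mathlib

open scoped ContDiff
open MeasureTheory Filter Topology

noncomputable section

namespace QuasilinearNLS

variable {E : Type*} [NormedAddCommGroup E] [NormedSpace ℝ E]

/-- `g` is a weak (distributional) first derivative of `u` on `ℝ`: both are locally integrable and
`∫ φ' u = - ∫ φ g` for every test function `φ ∈ C_c^∞(ℝ)`. -/
def IsWeakDeriv (u g : ℝ → E) : Prop :=
  LocallyIntegrable u volume ∧ LocallyIntegrable g volume ∧
    ∀ φ : ℝ → ℝ, ContDiff ℝ ∞ φ → HasCompactSupport φ →
      ∫ x, deriv φ x • u x = - ∫ x, φ x • g x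

open Classical in
/-- The weak derivative of `u`, determined up to a null set; it is set to `0` if `u` has no
locally integrable weak derivative. -/
def weakDeriv (u : ℝ → E) : ℝ → E :=
  if h : ∃ g, IsWeakDeriv u g then h.choose else 0

/-- Membership in `H¹(ℝ) = W^{1,2}(ℝ)` (complex valued): `u` and its weak derivative are in `L²`. -/
def MemH1 (u : ℝ → ℂ) : Prop :=
  MemLp u 2 volume ∧ ∃ g : ℝ → ℂ, MemLp g 2 volume ∧ IsWeakDeriv u g

/-- The norm of `H¹(ℝ)`: `‖u‖² = ∫ (|u'|² + |u|²)`. -/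
def h1Norm (u : ℝ → ℂ) : ℝ :=
  Real.sqrt (∫ x, (‖weakDeriv u x‖ ^ 2 + ‖u x‖ ^ 2))

/-- `I(u) = ∫ [ ½|u'|² + (k/4)|(|u|²)'|² - (θ/p)|u|^p ]`. -/
def energy (k θ p : ℝ) (u : ℝ → ℂ) : ℝ :=
  ∫ x, ((1 / 2) * ‖weakDeriv u x‖ ^ 2
    + (k / 4) * |weakDeriv (fun y => ‖u y‖ ^ 2) x| ^ 2
    - (θ / p) * ‖u x‖ ^ p)

/-- The constraint set `M = {u ∈ H¹(ℝ) : ½ ∫ |u|² = lam}`. -/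
def massSphere (lam : ℝ) : Set (ℝ → ℂ) :=
  {u | MemH1 u ∧ (1 / 2) * ∫ x, ‖u x‖ ^ 2 = lam}

/-- `m = inf {I(u) : u ∈ M}`. -/
def minEnergy (k θ p lam : ℝ) : ℝ :=
  sInf (energy k θ p '' massSphere lam)

end QuasilinearNLS

end

/-! Put ν = m/(2λ) and J(u) = I(u) - ν∫|u|², so that J → 0 along minimizing sequences. The dilation
u(x/t) multiplies ∫|u|² and ∫|u|^p by t and divides both gradient terms by t. Comparing with m at
mass 2λ gives J ≥ 0 whenever ∫|u|² ≤ 2λ (`action_nonneg`), and J ≤ 0 with u and u' nonzero forces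
∫|u|² ≥ 2λ (`le_mass_of_action_nonpos`). These two facts play the role of strict subadditivity in
concentration-compactness.

On the line ‖u‖_∞² ≤ 2‖u‖₂‖u'‖₂, so at fixed mass ∫|u|^p is controlled by ‖u'‖₂^{(p-2)/2}, a power
below 2 because p < 6: m is finite and minimizing sequences are bounded in H¹. Spreading out a fixed
profile makes the potential term dominate, again because p < 6, so m < 0. Hence the sup norms of a
minimizing sequence stay away from 0, and suitable translates have a nonzero limit w, pointwise for
values and weakly in L² for derivatives.

The key point is J(w) ≤ 0 (`action_nonpos`). On [-R, R] the action is weakly lower semicontinuous.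
Each outer piece, closed off by a decaying exponential, is an H¹ function of mass at most 2λ, so its
action is nonnegative up to an error governed by the boundary value, which is small for well-chosen
R. Thus w has full mass and I(w) = m. No mass being lost, values converge in L² and L^p, and the
square surplus in `exists_kinetic_ge` upgrades the derivatives to strong convergence. Passing from w
to |w| does not raise I. -/

noncomputable section

namespace QuasilinearNLS

/-! ### Absolutely continuous functions and weak derivatives on the line. -/

section Primitives

variable {E : Type*} [NormedAddCommGroup E] [NormedSpace ℝ E]

/-! ### Primitives of locally integrable functions -/

/-- `u` is a primitive of the locally integrable function `g`, i.e. `u` is locally absolutely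
continuous with derivative `g`. -/
structure IsPrimitive (u g : ℝ → E) : Prop where
  locallyIntegrable : LocallyIntegrable g volume
  sub_eq : ∀ a b, u b - u a = ∫ x in a..b, g x

theorem _root_.MeasureTheory.LocallyIntegrable.intervalIntegrable_real {F : Type*}
    [NormedAddCommGroup F] {g : ℝ → F}
    (hg : LocallyIntegrable g volume) (a b : ℝ) : IntervalIntegrable g volume a b :=
  intervalIntegrable_iff.mpr <|
    (hg.integrableOn_isCompact isCompact_uIcc).mono_set Set.uIoc_subset_uIcc

theorem IsPrimitive.intervalIntegrable {u g : ℝ → E} (h : IsPrimitive u g) (a b : ℝ) :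
    IntervalIntegrable g volume a b :=
  h.locallyIntegrable.intervalIntegrable_real a b

theorem isPrimitive_integral {g : ℝ → E} (hg : LocallyIntegrable g volume) (c : ℝ) :
    IsPrimitive (fun x => ∫ t in c..x, g t) g :=
  ⟨hg, fun _ _ => intervalIntegral.integral_interval_sub_left
    (hg.intervalIntegrable_real _ _) (hg.intervalIntegrable_real _ _)⟩

theorem IsPrimitive.eq_add_integral {u g : ℝ → E} (h : IsPrimitive u g) (c : ℝ) :
    u = fun x => u c + ∫ t in c..x, g t := by
  ext x
  rw [← h.sub_eq c x]
  abel

theorem IsPrimitive.continuous {u g : ℝ → E} (h : IsPrimitive u g) : Continuous u := by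
  rw [h.eq_add_integral 0]
  exact continuous_const.add (intervalIntegral.continuous_primitive h.intervalIntegrable 0)

theorem IsPrimitive.sub {u g v h : ℝ → E} (hu : IsPrimitive u g) (hv : IsPrimitive v h) :
    IsPrimitive (fun x => u x - v x) (fun x => g x - h x) := by
  refine ⟨hu.locallyIntegrable.sub hv.locallyIntegrable, fun a b => ?_⟩
  rw [intervalIntegral.integral_sub (hu.intervalIntegrable a b) (hv.intervalIntegrable a b),
    ← hu.sub_eq, ← hv.sub_eq]
  abel

theorem IsPrimitive.ae_hasDerivAt [CompleteSpace E] {u g : ℝ → E} (h : IsPrimitive u g) :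
    ∀ᵐ x, HasDerivAt u (g x) x := by
  filter_upwards [LocallyIntegrable.ae_hasDerivAt_integral h.locallyIntegrable] with x hx
  rw [h.eq_add_integral 0]
  exact (hx 0).const_add _

theorem absolutelyContinuousOnInterval_of_dist_le {X Y : Type*} [PseudoMetricSpace X]
    [PseudoMetricSpace Y] {f : ℝ → X} {g : ℝ → Y} {a b : ℝ}
    (hg : AbsolutelyContinuousOnInterval g a b)
    (h : ∀ x y, dist (f x) (f y) ≤ dist (g x) (g y)) : AbsolutelyContinuousOnInterval f a b :=
  squeeze_zero (fun _ => Finset.sum_nonneg fun _ _ => dist_nonneg)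
    (fun _ => Finset.sum_le_sum fun _ _ => h _ _) hg

/-- Increments of `u` are dominated by those of the real primitive of `‖g‖`. -/
theorem IsPrimitive.absolutelyContinuousOnInterval {u g : ℝ → E} (h : IsPrimitive u g)
    (a b : ℝ) : AbsolutelyContinuousOnInterval u a b := by
  have h1 := (h.intervalIntegrable a b).norm.absolutelyContinuousOnInterval_intervalIntegral
    (c := a) (by simp)
  refine absolutelyContinuousOnInterval_of_dist_le h1 fun x y => ?_
  rw [dist_comm, dist_eq_norm, h.sub_eq, dist_comm, Real.dist_eq,
    intervalIntegral.integral_interval_sub_left (h.intervalIntegrable _ _).norm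
      (h.intervalIntegrable _ _).norm]
  exact intervalIntegral.norm_integral_le_abs_integral_norm

/-- The difference between `F` and a primitive of `f` is absolutely continuous with derivative zero
almost everywhere, hence constant. -/
theorem isPrimitive_of_absolutelyContinuous [CompleteSpace E] {F f : ℝ → E}
    (hF : ∀ a b, AbsolutelyContinuousOnInterval F a b) (hf : LocallyIntegrable f volume)
    (hd : ∀ᵐ x, HasDerivAt F (f x) x) : IsPrimitive F f := by
  refine ⟨hf, fun a b => ?_⟩
  have hp := isPrimitive_integral hf a
  obtain ⟨C, hC⟩ := ((hF a b).sub (hp.absolutelyContinuousOnInterval a b)).const_of_ae_hasDerivAt_zero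
    (by
      filter_upwards [hd, hp.ae_hasDerivAt] with x h1 h2 _
      simpa using h1.sub h2)
  have h1 := hC a (by simp)
  have h2 := hC b (by simp)
  simp only [Pi.sub_apply, intervalIntegral.integral_same, sub_zero] at h1 h2
  rw [h1, ← h2]
  abel

theorem IsPrimitive.norm_sq {u g : ℝ → ℂ} (h : IsPrimitive u g) :
    IsPrimitive (fun x => ‖u x‖ ^ 2) (fun x => 2 * inner ℝ (u x) (g x)) := by
  refine isPrimitive_of_absolutelyContinuous (fun a b => ?_) ?_ ?_
  · have h1 : AbsolutelyContinuousOnInterval (fun x => ‖u x‖) a b :=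
      absolutelyContinuousOnInterval_of_dist_le (h.absolutelyContinuousOnInterval a b)
        fun x y => by
          rw [Real.dist_eq, dist_eq_norm]
          exact abs_norm_sub_norm_le _ _
    simpa only [pow_two] using h1.fun_mul h1
  · rw [locallyIntegrable_iff]
    intro K hK
    have h1 := (h.locallyIntegrable.integrableOn_isCompact hK)
    obtain ⟨C, hC⟩ := hK.exists_bound_of_continuousOn h.continuous.continuousOn
    refine Integrable.mono' (h1.norm.const_mul (2 * C)) ?_ ?_
    · exact ((h.continuous.aestronglyMeasurable.inner h1.aestronglyMeasurable)).const_mul 2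
    · filter_upwards [ae_restrict_mem hK.measurableSet] with x hx
      rw [norm_mul, Real.norm_two, mul_assoc]
      gcongr
      exact (norm_inner_le_norm _ _).trans (by gcongr; exact hC x hx)
  · filter_upwards [h.ae_hasDerivAt] with x hx using hx.norm_sq

/-- By the reverse triangle inequality, difference quotients of `‖u‖` are dominated by those of `u`;
this gives both absolute continuity and the bound on the derivative. -/
theorem IsPrimitive.exists_norm {u g : ℝ → ℂ} (h : IsPrimitive u g) :
    ∃ r : ℝ → ℝ, IsPrimitive (fun x => ‖u x‖) r ∧ ∀ᵐ x, ‖r x‖ ≤ ‖g x‖ := by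
  have hac : ∀ a b, AbsolutelyContinuousOnInterval (fun x => ‖u x‖) a b := fun a b =>
    absolutelyContinuousOnInterval_of_dist_le (h.absolutelyContinuousOnInterval a b)
        fun x y => by
          rw [Real.dist_eq, dist_eq_norm]
          exact abs_norm_sub_norm_le _ _
  have hdiff : ∀ᵐ x, DifferentiableAt ℝ (fun x => ‖u x‖) x := by
    have : ∀ᵐ x : ℝ, ∀ n : ℕ, x ∈ Set.uIcc (-n : ℝ) n →
        DifferentiableAt ℝ (fun x => ‖u x‖) x :=
      ae_all_iff.mpr fun n => (hac _ _).ae_differentiableAt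
    filter_upwards [this] with x hx
    obtain ⟨n, hn⟩ := exists_nat_ge |x|
    refine hx n ?_
    rw [Set.uIcc_of_le (by linarith [abs_nonneg x])]
    exact abs_le.mp hn
  have hle : ∀ᵐ x, ‖deriv (fun x => ‖u x‖) x‖ ≤ ‖g x‖ := by
    filter_upwards [hdiff, h.ae_hasDerivAt] with x hx hu
    have h1 := (hasDerivAt_iff_tendsto_slope.mp hx.hasDerivAt).norm
    have h2 := (hasDerivAt_iff_tendsto_slope.mp hu).norm
    refine le_of_tendsto_of_tendsto' h1 h2 fun y => ?_
    simp only [slope, vsub_eq_sub, norm_smul]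
    gcongr
    exact abs_norm_sub_norm_le _ _
  refine ⟨deriv (fun x => ‖u x‖), isPrimitive_of_absolutelyContinuous hac ?_ ?_, hle⟩
  · exact h.locallyIntegrable.mono (measurable_deriv _).aestronglyMeasurable hle
  · filter_upwards [hdiff] with x hx using hx.hasDerivAt

/-! ### Weak derivatives and primitives -/

theorem IsPrimitive.isWeakDeriv [CompleteSpace E] {u g : ℝ → E} (h : IsPrimitive u g) :
    IsWeakDeriv u g := by
  refine ⟨h.continuous.locallyIntegrable, h.locallyIntegrable, fun φ hφ hc => ?_⟩
  have hφ' : Continuous (deriv φ) := hφ.continuous_deriv (by simp)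
  have i1 : Integrable (fun x => deriv φ x • u x) :=
    h.continuous.locallyIntegrable.integrable_smul_left_of_hasCompactSupport hφ' hc.deriv
  have i2 : Integrable (fun x => φ x • g x) :=
    h.locallyIntegrable.integrable_smul_left_of_hasCompactSupport hφ.continuous hc
  have hp : IsPrimitive (fun x => φ x • u x) (fun x => φ x • g x + deriv φ x • u x) := by
    refine isPrimitive_of_absolutelyContinuous (fun a b => ?_) (i2.add i1).locallyIntegrable ?_
    · exact (hφ.contDiffOn.of_le (by simp)).absolutelyContinuousOnInterval.fun_smul
        (h.absolutelyContinuousOnInterval a b)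
    · filter_upwards [h.ae_hasDerivAt] with x hx
      exact ((hφ.differentiable (by simp)) x).hasDerivAt.smul hx
  obtain ⟨R, hR⟩ := hc.isCompact.isBounded.subset_closedBall 0
  have hz : ∀ x, R < |x| → φ x = 0 := fun x hx => by
    by_contra hne
    have := hR (subset_tsupport _ hne)
    simp at this
    linarith
  have h3 := intervalIntegral_tendsto_integral (i2.add i1) tendsto_neg_atTop_atBot tendsto_id
  -- The integrand is the derivative of `φ • u`, which vanishes at both endpoints.
  have h4 : ∀ᶠ r : ℝ in atTop, ∫ x in (-r)..r, (φ x • g x + deriv φ x • u x) = 0 := by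
    filter_upwards [eventually_gt_atTop R, eventually_gt_atTop 0] with r hr hr0
    rw [← hp.sub_eq, hz r (by rwa [abs_of_pos hr0]), hz (-r) (by rwa [abs_neg, abs_of_pos hr0])]
    simp
  have h5 := tendsto_nhds_unique h3 (tendsto_const_nhds.congr' (h4.mono fun _ h => h.symm))
  simp only [Pi.add_apply] at h5
  rw [integral_add i2 i1] at h5
  exact eq_neg_of_add_eq_zero_right h5

theorem IsWeakDeriv.ae_unique [CompleteSpace E] {u g g' : ℝ → E} (h : IsWeakDeriv u g) (h' : IsWeakDeriv u g') :
    g =ᵐ[volume] g' := by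
  refine ae_eq_of_integral_contDiff_smul_eq h.2.1 h'.2.1 fun φ hφ hc => ?_
  rw [← neg_inj, ← h.2.2 φ hφ hc, h'.2.2 φ hφ hc]

theorem IsWeakDeriv.weakDeriv_ae_eq [CompleteSpace E] {u g : ℝ → E} (h : IsWeakDeriv u g) :
    weakDeriv u =ᵐ[volume] g := by
  have hex : ∃ g, IsWeakDeriv u g := ⟨g, h⟩
  rw [weakDeriv, dif_pos hex]
  exact hex.choose_spec.ae_unique h

theorem IsWeakDeriv.congr {u v g : ℝ → E} (h : IsWeakDeriv u g) (huv : u =ᵐ[volume] v) :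
    IsWeakDeriv v g := by
  refine ⟨h.1.congr huv, h.2.1, fun φ hφ hc => ?_⟩
  rw [← h.2.2 φ hφ hc]
  exact integral_congr_ae (huv.mono fun x hx => by simp only [hx])

/-- Du Bois-Reymond: with `ρ` a bump of integral one, `η - (∫ η) ρ` has mean zero, so it is the
derivative of a test function and is annihilated by `u`. Thus `u` acts on every `η` as the constant
`∫ ρ u`. -/
theorem weakDeriv_zero_ae_const [CompleteSpace E] {u : ℝ → E} (h : IsWeakDeriv u 0) :
    ∃ c, u =ᵐ[volume] fun _ => c := by
  obtain ⟨ψ⟩ : Nonempty (ContDiffBump (0 : ℝ)) := inferInstance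
  set ρ : ℝ → ℝ := ψ.normed volume
  have hρ : ContDiff ℝ ∞ ρ := ψ.contDiff_normed
  have hρc : HasCompactSupport ρ := ψ.hasCompactSupport_normed
  have hρ1 : ∫ x, ρ x = 1 := ψ.integral_normed
  refine ⟨∫ x, ρ x • u x, ?_⟩
  refine ae_eq_of_integral_contDiff_smul_eq h.1 (locallyIntegrable_const _) fun η hη hηc => ?_
  set I := ∫ x, η x
  set f : ℝ → ℝ := fun x => η x - I * ρ x
  have hf : ContDiff ℝ ∞ f := hη.sub (contDiff_const.mul hρ)
  have hfc : HasCompactSupport f := hηc.sub hρc.mul_left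
  have iη : Integrable η := hη.continuous.integrable_of_hasCompactSupport hηc
  have iρ : Integrable ρ := hρ.continuous.integrable_of_hasCompactSupport hρc
  have hf0 : ∫ x, f x = 0 := by
    rw [integral_sub iη (iρ.const_mul I), integral_const_mul, hρ1, mul_one, sub_self]
  obtain ⟨R, hR⟩ := hfc.isCompact.isBounded.subset_closedBall 0
  have hz : ∀ x, R < |x| → f x = 0 := fun x hx => by
    by_contra hne
    have := hR (subset_tsupport _ hne)
    simp at this
    linarith
  have if' : Integrable f := iη.sub (iρ.const_mul I)
  set φ : ℝ → ℝ := fun x => ∫ t in (-R - 1)..x, f t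
  have hderiv : ∀ x, HasDerivAt φ (f x) x := fun x =>
    intervalIntegral.integral_hasDerivAt_right (if'.intervalIntegrable)
      (hf.continuous.stronglyMeasurableAtFilter _ _) hf.continuous.continuousAt
  have hφ' : deriv φ = f := funext fun x => (hderiv x).deriv
  have hφ : ContDiff ℝ ∞ φ := by
    rw [contDiff_infty_iff_deriv, hφ']
    exact ⟨fun x => (hderiv x).differentiableAt, hf⟩
  have hφc : HasCompactSupport φ := by
    refine HasCompactSupport.of_support_subset_isCompact (isCompact_Icc (a := -R - 1) (b := R + 1)) ?_
    intro x hx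
    by_contra hne
    apply hx
    rw [Set.mem_Icc, not_and_or, not_le, not_le] at hne
    rcases hne with hlt | hlt
    · refine intervalIntegral.integral_zero_ae (Eventually.of_forall fun t ht => hz t ?_)
      rw [Set.uIoc_of_ge hlt.le, Set.mem_Ioc] at ht
      by_contra! hc
      linarith [(abs_le.mp hc).1]
    · have : φ x = ∫ t, f t := by
        by_cases hR0 : -R - 1 ≤ x
        · refine intervalIntegral.integral_eq_integral_of_support_subset fun t ht => ?_
          by_contra hne
          apply ht
          apply hz
          rw [Set.mem_Ioc, not_and_or, not_lt, not_le] at hne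
          by_contra! hc
          rcases hne with h | h
          · linarith [(abs_le.mp hc).1]
          · linarith [(abs_le.mp hc).2]
        · have hR' : ∀ t, f t = 0 := fun t => hz t (by linarith [abs_nonneg t])
          simp [φ, hR']
      rw [this, hf0]
  have key := h.2.2 φ hφ hφc
  simp only [hφ', Pi.zero_apply, smul_zero, integral_zero, neg_zero] at key
  have j1 : Integrable (fun x => η x • u x) :=
    h.1.integrable_smul_left_of_hasCompactSupport hη.continuous hηc
  have j2 : Integrable (fun x => ρ x • u x) :=
    h.1.integrable_smul_left_of_hasCompactSupport hρ.continuous hρc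
  have : ∫ x, f x • u x = ∫ x, (η x • u x - I • (ρ x • u x)) := by
    congr 1; ext x; simp only [f, sub_smul, mul_smul]
  rw [this, integral_sub j1 (j2.fun_smul I), integral_smul, sub_eq_zero] at key
  rw [key, integral_smul_const]

/-- Subtracting a primitive of `g` leaves a function with weak derivative zero. -/
theorem IsWeakDeriv.exists_isPrimitive [CompleteSpace E] {u g : ℝ → E} (h : IsWeakDeriv u g) :
    ∃ v, IsPrimitive v g ∧ u =ᵐ[volume] v := by
  have hp := isPrimitive_integral h.2.1 0
  have hw := hp.isWeakDeriv
  obtain ⟨c, hc⟩ := weakDeriv_zero_ae_const (u := fun x => u x - ∫ t in (0 : ℝ)..x, g t)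
    ⟨h.1.sub hw.1, locallyIntegrable_zero, fun φ hφ hφc => by
      have hφ' : Continuous (deriv φ) := hφ.continuous_deriv (by simp)
      simp only [smul_sub, Pi.zero_apply, smul_zero, integral_zero, neg_zero]
      rw [integral_sub (h.1.integrable_smul_left_of_hasCompactSupport hφ' hφc.deriv)
        (hw.1.integrable_smul_left_of_hasCompactSupport hφ' hφc.deriv), h.2.2 φ hφ hφc,
        hw.2.2 φ hφ hφc, sub_self]⟩
  refine ⟨fun x => c + ∫ t in (0 : ℝ)..x, g t, ⟨h.2.1, fun a b => ?_⟩, ?_⟩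
  · rw [← hp.sub_eq a b]
    abel
  · filter_upwards [hc] with x hx
    rw [← hx]
    abel

end Primitives

/-! ### H¹ functions through their continuous representatives: energy, scaling, gluing. -/

section Pairs

/-! ### Continuous representatives of `H¹` functions -/

/-- `u` is the continuous representative of an `H¹` function with weak derivative `g`. -/
structure H1Pair (u g : ℝ → ℂ) : Prop where
  memLp : MemLp u 2 volume
  memLp_deriv : MemLp g 2 volume
  sub_eq : ∀ a b, u b - u a = ∫ x in a..b, g x

namespace H1Pair

variable {u g v h : ℝ → ℂ} {k θ p : ℝ}

theorem isPrimitive (hu : H1Pair u g) : IsPrimitive u g :=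
  ⟨hu.memLp_deriv.locallyIntegrable (by norm_num), hu.sub_eq⟩

theorem continuous (hu : H1Pair u g) : Continuous u := hu.isPrimitive.continuous

theorem integrable_sq (hu : H1Pair u g) : Integrable (fun x => ‖u x‖ ^ 2) :=
  hu.memLp.integrable_norm_pow (p := 2) (by norm_num)

theorem integrable_deriv_sq (hu : H1Pair u g) : Integrable (fun x => ‖g x‖ ^ 2) :=
  hu.memLp_deriv.integrable_norm_pow (p := 2) (by norm_num)

theorem sub (hu : H1Pair u g) (hv : H1Pair v h) :
    H1Pair (fun x => u x - v x) (fun x => g x - h x) :=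
  ⟨hu.memLp.sub hv.memLp, hu.memLp_deriv.sub hv.memLp_deriv,
    (hu.isPrimitive.sub hv.isPrimitive).sub_eq⟩

end H1Pair

theorem integrable_mul_norm {u g : ℝ → ℂ} {μ : Measure ℝ} (hu : MemLp u 2 μ) (hg : MemLp g 2 μ) :
    Integrable (fun x => ‖u x‖ * ‖g x‖) μ :=
  hu.norm.integrable_mul hg.norm

theorem integral_mul_norm_le {u g : ℝ → ℂ} {μ : Measure ℝ} (hu : MemLp u 2 μ) (hg : MemLp g 2 μ) :
    ∫ x, ‖u x‖ * ‖g x‖ ∂μ ≤ √(∫ x, ‖u x‖ ^ 2 ∂μ) * √(∫ x, ‖g x‖ ^ 2 ∂μ) := by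
  have := integral_mul_le_Lp_mul_Lq_of_nonneg (μ := μ) Real.HolderConjugate.two_two
    (f := fun x => ‖u x‖) (g := fun x => ‖g x‖)
    (Eventually.of_forall fun _ => norm_nonneg _) (Eventually.of_forall fun _ => norm_nonneg _)
    (by simpa using hu.norm) (by simpa using hg.norm)
  simpa [Real.sqrt_eq_rpow] using this

/-- An integrable function takes small values arbitrarily far to the right. -/
theorem exists_ge_lt_of_integrable {f : ℝ → ℝ} (hf : Integrable f) {ε : ℝ} (hε : 0 < ε) (R : ℝ) :
    ∃ x ≥ R, f x < ε := by
  by_contra! hcon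
  have h1 : IntegrableOn (fun _ : ℝ => ε) (Set.Ioi R) := by
    refine Integrable.mono' hf.integrableOn aestronglyMeasurable_const ?_
    filter_upwards [ae_restrict_mem measurableSet_Ioi] with x hx
    rw [Real.norm_of_nonneg hε.le]
    exact hcon x (le_of_lt hx)
  rw [integrableOn_const_iff] at h1
  rcases h1 with h1 | h1
  · exact hε.ne' (by simpa using h1)
  · simp at h1

namespace H1Pair

variable {u g v h : ℝ → ℂ} {k θ p : ℝ}

/-- Integrate the derivative `2⟨u, g⟩` of `|u|²` from a point where `|u|²` is below `ε`, and apply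
Cauchy-Schwarz. -/
theorem norm_sq_le (hu : H1Pair u g) (x : ℝ) :
    ‖u x‖ ^ 2 ≤ 2 * (√(∫ x, ‖u x‖ ^ 2) * √(∫ x, ‖g x‖ ^ 2)) := by
  refine le_of_forall_pos_le_add fun ε hε => ?_
  obtain ⟨y, -, hy⟩ := exists_ge_lt_of_integrable hu.integrable_sq hε 0
  have h1 := hu.isPrimitive.norm_sq.sub_eq y x
  have hi := (integrable_mul_norm hu.memLp hu.memLp_deriv).const_mul 2
  have h2 : ∫ t in y..x, 2 * inner ℝ (u t) (g t) ≤ ∫ t, 2 * (‖u t‖ * ‖g t‖) := by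
    refine (le_abs_self _).trans ?_
    rw [← Real.norm_eq_abs]
    refine intervalIntegral.norm_integral_le_integral_norm_uIoc.trans ?_
    refine (integral_mono_of_nonneg (Eventually.of_forall fun _ => norm_nonneg _)
      hi.integrableOn (Eventually.of_forall fun t => ?_)).trans
      (setIntegral_le_integral hi (Eventually.of_forall fun t => ?_))
    · simp only [norm_mul, Real.norm_two]
      gcongr
      exact norm_inner_le_norm _ _
    · simp only [Pi.zero_apply]; positivity
  rw [integral_const_mul] at h2
  have h3 := integral_mul_norm_le hu.memLp hu.memLp_deriv
  linarith

theorem exists_bound (hu : H1Pair u g) : ∃ C, 0 ≤ C ∧ ∀ x, ‖u x‖ ≤ C :=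
  ⟨√(2 * (√(∫ x, ‖u x‖ ^ 2) * √(∫ x, ‖g x‖ ^ 2))), Real.sqrt_nonneg _,
    fun x => Real.le_sqrt_of_sq_le (hu.norm_sq_le x)⟩

theorem rpow_le (hp : 2 ≤ p) {C a : ℝ} (ha : 0 ≤ a) (hC : a ≤ C) :
    a ^ p ≤ C ^ (p - 2) * a ^ 2 := by
  rcases ha.eq_or_lt with rfl | h0
  · rw [Real.zero_rpow (by linarith)]; simp
  · calc a ^ p = a ^ (p - 2) * a ^ 2 := by
          rw [← Real.rpow_natCast a 2, ← Real.rpow_add h0]; norm_num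
      _ ≤ C ^ (p - 2) * a ^ 2 := by
          gcongr

theorem integrable_rpow (hu : H1Pair u g) (hp : 2 ≤ p) : Integrable (fun x => ‖u x‖ ^ p) := by
  obtain ⟨C, -, hC⟩ := hu.exists_bound
  refine Integrable.mono' (hu.integrable_sq.const_mul (C ^ (p - 2))) ?_ ?_
  · exact (hu.continuous.norm.rpow_const fun x => Or.inr (by linarith)).aestronglyMeasurable
  · refine Eventually.of_forall fun x => ?_
    rw [Real.norm_of_nonneg (by positivity)]
    exact rpow_le hp (norm_nonneg _) (hC x)

theorem integral_rpow_le (hu : H1Pair u g) (hp : 2 ≤ p) {C : ℝ} (hC : ∀ x, ‖u x‖ ≤ C) :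
    ∫ x, ‖u x‖ ^ p ≤ C ^ (p - 2) * ∫ x, ‖u x‖ ^ 2 := by
  rw [← integral_const_mul]
  exact integral_mono (hu.integrable_rpow hp) (hu.integrable_sq.const_mul _)
    fun x => rpow_le hp (norm_nonneg _) (hC x)

theorem memLp_inner (hu : H1Pair u g) : MemLp (fun x => 2 * inner ℝ (u x) (g x)) 2 := by
  obtain ⟨C, hC0, hC⟩ := hu.exists_bound
  refine MemLp.of_le_mul (c := 2 * C) hu.memLp_deriv
    ((hu.continuous.aestronglyMeasurable.inner hu.memLp_deriv.1).const_mul 2)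
    (Eventually.of_forall fun x => ?_)
  rw [norm_mul, Real.norm_two, mul_assoc]
  gcongr
  exact (norm_inner_le_norm _ _).trans (by gcongr; exact hC x)

theorem integrable_inner_sq (hu : H1Pair u g) :
    Integrable (fun x => (2 * inner ℝ (u x) (g x)) ^ 2) :=
  hu.memLp_inner.integrable_sq

end H1Pair

/-! ### The energy in terms of the continuous representative -/

/-- The energy density at value `a` and slope `b`. -/
def density (k θ p : ℝ) (a b : ℂ) : ℝ :=
  1 / 2 * ‖b‖ ^ 2 + k / 4 * (2 * inner ℝ a b) ^ 2 - θ / p * ‖a‖ ^ p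

/-- The energy of the pair `(u, g)`. -/
def pairEnergy (k θ p : ℝ) (u g : ℝ → ℂ) : ℝ := ∫ x, density k θ p (u x) (g x)

namespace H1Pair

variable {u g v h : ℝ → ℂ} {k θ p : ℝ}

theorem integrable_density (hu : H1Pair u g) (hp : 2 ≤ p) :
    Integrable (fun x => density k θ p (u x) (g x)) :=
  ((hu.integrable_deriv_sq.const_mul _).add (hu.integrable_inner_sq.const_mul _)).sub
    ((hu.integrable_rpow hp).const_mul _)

theorem pairEnergy_eq (hu : H1Pair u g) (hp : 2 ≤ p) :
    pairEnergy k θ p u g = 1 / 2 * (∫ x, ‖g x‖ ^ 2)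
      + k / 4 * (∫ x, (2 * inner ℝ (u x) (g x)) ^ 2) - θ / p * ∫ x, ‖u x‖ ^ p := by
  unfold pairEnergy density
  rw [integral_sub ((hu.integrable_deriv_sq.const_mul _).fun_add (hu.integrable_inner_sq.const_mul _))
    ((hu.integrable_rpow hp).const_mul _), integral_add (hu.integrable_deriv_sq.const_mul _)
    (hu.integrable_inner_sq.const_mul _), integral_const_mul, integral_const_mul,
    integral_const_mul]

theorem isWeakDeriv (hu : H1Pair u g) (huv : v =ᵐ[volume] u) : IsWeakDeriv v g :=
  hu.isPrimitive.isWeakDeriv.congr huv.symm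

theorem memH1 (hu : H1Pair u g) (huv : v =ᵐ[volume] u) : MemH1 v :=
  ⟨hu.memLp.ae_eq huv.symm, g, hu.memLp_deriv, hu.isWeakDeriv huv⟩

/-- Uniqueness of weak derivatives removes the arbitrary choice in `weakDeriv`, both for `v` and for
`|v|²`. -/
theorem energy_eq (hu : H1Pair u g) (huv : v =ᵐ[volume] u) :
    energy k θ p v = pairEnergy k θ p u g := by
  have h1 := (hu.isWeakDeriv huv).weakDeriv_ae_eq
  have h2 : weakDeriv (fun y => ‖v y‖ ^ 2) =ᵐ[volume] fun x => 2 * inner ℝ (u x) (g x) :=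
    (hu.isPrimitive.norm_sq.isWeakDeriv.congr
      (huv.symm.mono fun x hx => by simp only [hx])).weakDeriv_ae_eq
  refine integral_congr_ae ?_
  filter_upwards [huv, h1, h2] with x h0 h1 h2
  simp only [density, h0, h1, h2, sq_abs]

theorem integral_sq_congr (huv : v =ᵐ[volume] u) : ∫ x, ‖v x‖ ^ 2 = ∫ x, ‖u x‖ ^ 2 :=
  integral_congr_ae (huv.mono fun x hx => by simp only [hx])

theorem mem_massSphere (hu : H1Pair u g) (huv : v =ᵐ[volume] u) {lam : ℝ}
    (hm : ∫ x, ‖u x‖ ^ 2 = 2 * lam) : v ∈ massSphere lam :=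
  ⟨hu.memH1 huv, by rw [integral_sq_congr huv, hm]; ring⟩

theorem h1Norm_eq (hu : H1Pair u g) (huv : v =ᵐ[volume] u) :
    h1Norm v = √((∫ x, ‖g x‖ ^ 2) + ∫ x, ‖u x‖ ^ 2) := by
  rw [h1Norm, ← integral_add hu.integrable_deriv_sq hu.integrable_sq]
  congr 1
  refine integral_congr_ae ?_
  filter_upwards [huv, (hu.isWeakDeriv huv).weakDeriv_ae_eq] with x h0 h1
  simp only [h0, h1]

end H1Pair

theorem exists_h1Pair_of_mem_massSphere {lam : ℝ} {v : ℝ → ℂ} (hv : v ∈ massSphere lam) :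
    ∃ u g, H1Pair u g ∧ v =ᵐ[volume] u ∧ ∫ x, ‖u x‖ ^ 2 = 2 * lam := by
  obtain ⟨⟨hv2, g, hg, hw⟩, hm⟩ := hv
  obtain ⟨u, hu, huv⟩ := hw.exists_isPrimitive
  refine ⟨u, g, ⟨hv2.ae_eq huv, hg, hu.sub_eq⟩, huv, ?_⟩
  rw [← H1Pair.integral_sq_congr huv]
  linarith

/-! ### Affine changes of variables -/

theorem integral_comp_mul_add (f : ℝ → ℝ) (a b : ℝ) :
    ∫ x, f (a * x + b) = |a|⁻¹ * ∫ x, f x := by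
  rw [Measure.integral_comp_mul_left (fun y => f (y + b)) a, integral_add_right_eq_self, abs_inv,
    smul_eq_mul]

theorem memLp_comp_mul_add {f : ℝ → ℂ} (hf : MemLp f 2 volume) {a : ℝ} (ha : a ≠ 0) (b : ℝ) :
    MemLp (fun x => f (a * x + b)) 2 volume := by
  have hq : Measure.QuasiMeasurePreserving (fun x : ℝ => a * x + b) volume volume :=
    (measurePreserving_add_right volume b).quasiMeasurePreserving.comp
      (Measure.quasiMeasurePreserving_smul volume ha)
  have hm : AEStronglyMeasurable (fun x => f (a * x + b)) volume :=
    hf.1.comp_quasiMeasurePreserving hq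
  rw [memLp_two_iff_integrable_sq_norm hm]
  exact ((hf.integrable_norm_pow (p := 2) (by norm_num)).comp_add_right b).comp_mul_left' ha

namespace H1Pair

variable {u g v h : ℝ → ℂ} {k θ p : ℝ}

theorem comp_mul_add (hu : H1Pair u g) (c : ℝ) {a : ℝ} (ha : a ≠ 0) (b : ℝ) :
    H1Pair (fun x => c • u (a * x + b)) (fun x => (c * a) • g (a * x + b)) := by
  refine ⟨(memLp_comp_mul_add hu.memLp ha b).const_smul c,
    (memLp_comp_mul_add hu.memLp_deriv ha b).const_smul (c * a), fun s t => ?_⟩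
  rw [intervalIntegral.integral_smul, mul_smul, intervalIntegral.smul_integral_comp_mul_add,
    ← hu.sub_eq, smul_sub]

theorem integral_sq_comp (u : ℝ → ℂ) (c a b : ℝ) :
    ∫ x, ‖c • u (a * x + b)‖ ^ 2 = c ^ 2 * |a|⁻¹ * ∫ x, ‖u x‖ ^ 2 := by
  simp only [norm_smul, mul_pow, Real.norm_eq_abs, sq_abs]
  rw [integral_const_mul, integral_comp_mul_add (fun x => ‖u x‖ ^ 2), mul_assoc]

theorem integral_inner_comp (u g : ℝ → ℂ) (c a b : ℝ) :
    ∫ x, (2 * inner ℝ (c • u (a * x + b)) ((c * a) • g (a * x + b))) ^ 2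
      = c ^ 4 * a ^ 2 * |a|⁻¹ * ∫ x, (2 * inner ℝ (u x) (g x)) ^ 2 := by
  have : ∀ x, (2 * inner ℝ (c • u (a * x + b)) ((c * a) • g (a * x + b))) ^ 2
      = c ^ 4 * a ^ 2 * (2 * inner ℝ (u (a * x + b)) (g (a * x + b))) ^ 2 := fun x => by
    rw [real_inner_smul_left, real_inner_smul_right]; ring
  simp only [this]
  rw [integral_const_mul, integral_comp_mul_add (fun x => (2 * inner ℝ (u x) (g x)) ^ 2)]
  ring

theorem integral_rpow_comp (u : ℝ → ℂ) (c a b : ℝ) :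
    ∫ x, ‖c • u (a * x + b)‖ ^ p = |c| ^ p * |a|⁻¹ * ∫ x, ‖u x‖ ^ p := by
  simp only [norm_smul, Real.norm_eq_abs]
  simp only [Real.mul_rpow (abs_nonneg c) (norm_nonneg _)]
  rw [integral_const_mul, integral_comp_mul_add (fun x => ‖u x‖ ^ p), mul_assoc]

theorem pairEnergy_comp (hu : H1Pair u g) (hp : 2 ≤ p) (c : ℝ) {a : ℝ} (ha : a ≠ 0) (b : ℝ) :
    pairEnergy k θ p (fun x => c • u (a * x + b)) (fun x => (c * a) • g (a * x + b))
      = 1 / 2 * (c ^ 2 * |a| * ∫ x, ‖g x‖ ^ 2)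
        + k / 4 * (c ^ 4 * |a| * ∫ x, (2 * inner ℝ (u x) (g x)) ^ 2)
        - θ / p * (|c| ^ p * |a|⁻¹ * ∫ x, ‖u x‖ ^ p) := by
  have h1 : a ^ 2 * |a|⁻¹ = |a| := by
    rw [← sq_abs, pow_two, mul_assoc, mul_inv_cancel₀ (abs_ne_zero.mpr ha), mul_one]
  rw [(hu.comp_mul_add c ha b).pairEnergy_eq hp, integral_sq_comp, integral_inner_comp,
    integral_rpow_comp, mul_pow, mul_assoc (c ^ 2), mul_assoc (c ^ 4), h1]

theorem translate (hu : H1Pair u g) (y : ℝ) :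
    H1Pair (fun x => u (x + y)) (fun x => g (x + y)) := by
  simpa using hu.comp_mul_add 1 one_ne_zero y

theorem reflect (hu : H1Pair u g) : H1Pair (fun x => u (-x)) (fun x => -g (-x)) := by
  simpa using hu.comp_mul_add 1 (neg_ne_zero.mpr one_ne_zero) 0

end H1Pair

/-! ### Exponential extension from a half-line -/

theorem IsPrimitive.glue {E : Type*} [NormedAddCommGroup E] [NormedSpace ℝ E]
    {u₁ g₁ u₂ g₂ : ℝ → E} (h₁ : IsPrimitive u₁ g₁) (h₂ : IsPrimitive u₂ g₂) {R : ℝ}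
    (hR : u₁ R = u₂ R) :
    IsPrimitive (fun x => if x ≤ R then u₁ x else u₂ x) (fun x => if x ≤ R then g₁ x else g₂ x) := by
  have hloc : LocallyIntegrable (fun x => if x ≤ R then g₁ x else g₂ x) volume := by
    convert! (h₁.locallyIntegrable.indicator (measurableSet_Iic (a := R))).add
      (h₂.locallyIntegrable.indicator (measurableSet_Ioi (a := R))) using 1
    ext x
    by_cases hx : x ≤ R <;> simp [Set.indicator, hx, not_lt.mpr, not_le.mp]
  have key : ∀ b, (if b ≤ R then u₁ b else u₂ b) - u₁ R
      = ∫ x in R..b, (if x ≤ R then g₁ x else g₂ x) := by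
    intro b
    by_cases hb : b ≤ R
    · rw [if_pos hb, h₁.sub_eq]
      refine intervalIntegral.integral_congr_ae (Eventually.of_forall fun x hx => ?_)
      rw [Set.uIoc_of_ge hb] at hx
      rw [if_pos hx.2]
    · rw [if_neg hb, hR, h₂.sub_eq]
      refine intervalIntegral.integral_congr_ae (Eventually.of_forall fun x hx => ?_)
      rw [Set.uIoc_of_le (not_le.mp hb).le] at hx
      rw [if_neg (not_le.mpr hx.1)]
  refine ⟨hloc, fun a b => ?_⟩
  rw [← intervalIntegral.integral_interval_sub_left (hloc.intervalIntegrable_real R b)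
    (hloc.intervalIntegrable_real R a), ← key, ← key]
  abel

theorem isPrimitive_exp (c : ℂ) (R : ℝ) :
    IsPrimitive (fun x : ℝ => Real.exp (x - R) • c) (fun x : ℝ => Real.exp (x - R) • c) := by
  have hc : Continuous (fun x : ℝ => Real.exp (x - R) • c) := by fun_prop
  refine ⟨hc.locallyIntegrable, fun a b => ?_⟩
  rw [intervalIntegral.integral_eq_sub_of_hasDerivAt (f := fun x : ℝ => Real.exp (x - R) • c)
    (fun x _ => ?_) (hc.intervalIntegrable _ _)]
  have : HasDerivAt (fun x : ℝ => Real.exp (x - R)) (Real.exp (x - R)) x := by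
    simpa using ((hasDerivAt_id x).sub_const R).exp
  exact this.smul_const c

theorem norm_exp_smul_sq (c : ℂ) (R x : ℝ) :
    ‖Real.exp (x - R) • c‖ ^ 2 = ‖c‖ ^ 2 * Real.exp (-(2 * R)) * Real.exp (2 * x) := by
  rw [norm_smul, mul_pow, Real.norm_of_nonneg (Real.exp_pos _).le, ← Real.exp_nat_mul, mul_assoc,
    ← Real.exp_add, mul_comm]
  push_cast
  ring_nf

theorem integrableOn_exp_smul_sq (c : ℂ) (R : ℝ) :
    IntegrableOn (fun x => ‖Real.exp (x - R) • c‖ ^ 2) (Set.Iic R) := by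
  simp only [norm_exp_smul_sq]
  exact (integrableOn_exp_mul_Iic two_pos R).const_mul _

theorem integral_exp_smul_sq (c : ℂ) (R : ℝ) :
    ∫ x in Set.Iic R, ‖Real.exp (x - R) • c‖ ^ 2 = ‖c‖ ^ 2 / 2 := by
  simp only [norm_exp_smul_sq]
  rw [integral_const_mul, integral_exp_mul_Iic two_pos, mul_div_assoc', mul_assoc, ← Real.exp_add]
  simp

/-- The restriction of `u` to `(R, ∞)`, extended by `u R * exp (x - R)`. -/
def expExtend (R : ℝ) (u g : ℝ → ℂ) : ℝ → ℂ := fun x => if x ≤ R then Real.exp (x - R) • u R else g x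

/-- The exponential is its own derivative, so one extension formula serves both `u` and `g`, and the
two pieces agree at `R`. -/
theorem h1Pair_expExtend {u g : ℝ → ℂ} (h : IsPrimitive u g) (R : ℝ)
    (hu : MemLp u 2 (volume.restrict (Set.Ioi R))) (hg : MemLp g 2 (volume.restrict (Set.Ioi R))) :
    H1Pair (expExtend R u u) (expExtend R u g) := by
  have hexp : MemLp (fun x : ℝ => Real.exp (x - R) • u R) 2 (volume.restrict (Set.Iic R)) := by
    rw [memLp_two_iff_integrable_sq_norm (by fun_prop)]
    exact integrableOn_exp_smul_sq _ _
  have hpw : ∀ f : ℝ → ℂ, MemLp f 2 (volume.restrict (Set.Ioi R)) →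
      MemLp (expExtend R u f) 2 volume := fun f hf => by
    classical
    exact MemLp.piecewise (s := Set.Iic R) measurableSet_Iic hexp (by rwa [Set.compl_Iic])
  exact ⟨hpw u hu, hpw g hg, ((isPrimitive_exp (u R) R).glue h (by simp)).sub_eq⟩

theorem exists_h1Pair_pos : ∃ u g, H1Pair u g ∧ u 0 ≠ 0 := by
  have h := isPrimitive_exp 1 0
  have hr : IsPrimitive (fun x : ℝ => Real.exp (-x - 0) • (1 : ℂ))
      (fun x : ℝ => -(Real.exp (-x - 0) • (1 : ℂ))) := by
    have hc : Continuous (fun x : ℝ => -(Real.exp (-x - 0) • (1 : ℂ))) := by fun_prop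
    refine ⟨hc.locallyIntegrable, fun a b => ?_⟩
    rw [intervalIntegral.integral_neg,
      intervalIntegral.integral_comp_neg (fun x : ℝ => Real.exp (x - 0) • (1 : ℂ)), ← h.sub_eq]
    simp
  have hm : MemLp (fun x : ℝ => Real.exp (-x - 0) • (1 : ℂ)) 2 (volume.restrict (Set.Ioi 0)) := by
    rw [memLp_two_iff_integrable_sq_norm (by fun_prop)]
    have h0 : IntegrableOn (fun x : ℝ => ‖Real.exp (x - 0) • (1 : ℂ)‖ ^ 2) (Set.Iic (-0)) := by
      rw [neg_zero]
      exact integrableOn_exp_smul_sq 1 0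
    exact h0.comp_neg_Ici.mono_set Set.Ioi_subset_Ici_self
  -- The glued function is `exp (-|x|)`.
  exact ⟨_, _, h1Pair_expExtend hr 0 hm hm.neg, by simp [expExtend]⟩

end Pairs

/-! ### Bounds on the infimum and on the action. -/

section Bounds

variable {u g : ℝ → ℂ} {k θ p lam : ℝ}

/-! ### Coercivity and boundedness from below -/

theorem exists_mul_rpow_le (C : ℝ) (hC : 0 ≤ C) {s : ℝ} (hs0 : 0 < s) (hs1 : s < 1) :
    ∃ C', ∀ D : ℝ, 0 ≤ D → C * D ^ s ≤ D / 4 + C' := by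
  -- Beyond this threshold `D ^ (1 - s) ≥ 4 * C`, so `D / 4` absorbs `C * D ^ s`.
  set T := (4 * C) ^ (1 / (1 - s)) with hT
  have hT0 : 0 ≤ T := by positivity
  refine ⟨C * T ^ s, fun D hD => ?_⟩
  rcases le_total D T with h | h
  · have : C * D ^ s ≤ C * T ^ s := by gcongr
    linarith
  · have h1 : 4 * C ≤ D ^ (1 - s) := by
      calc 4 * C = T ^ (1 - s) := by
            rw [hT, ← Real.rpow_mul (by positivity), one_div_mul_cancel (by linarith),
              Real.rpow_one]
        _ ≤ D ^ (1 - s) := Real.rpow_le_rpow hT0 h (by linarith)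
    have h2 : D ^ (1 - s) * D ^ s = D := by
      rw [← Real.rpow_add_of_nonneg hD (by linarith) hs0.le]; simp
    have h3 : 4 * C * D ^ s ≤ D := by
      calc 4 * C * D ^ s ≤ D ^ (1 - s) * D ^ s := by gcongr
        _ = D := h2
    have : 0 ≤ C * T ^ s := by positivity
    linarith

/-- The sup bound gives `∫ |u|^p ≤ const * D ^ ((p - 2) / 4)` with `D = ∫ |u'|²`. The exponent is
below 1 exactly because `p < 6`, so half of the term `D / 2` survives. -/
theorem exists_coercive (hk : 0 ≤ k) (hθ : 0 < θ) (hlam : 0 < lam) (hp2 : 2 < p) (hp6 : p < 6) :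
    ∃ C, ∀ u g, H1Pair u g → ∫ x, ‖u x‖ ^ 2 = 2 * lam →
      1 / 4 * (∫ x, ‖g x‖ ^ 2) ≤ pairEnergy k θ p u g + C := by
  set A := θ / p * ((2 * √(2 * lam)) ^ ((p - 2) / 2) * (2 * lam)) with hA
  have hp0 : 0 < p := by linarith
  obtain ⟨C, hC⟩ := exists_mul_rpow_le A (by positivity) (s := (p - 2) / 4) (by linarith)
    (by linarith)
  refine ⟨C, fun u g hu hm => ?_⟩
  set D := ∫ x, ‖g x‖ ^ 2
  have hD : 0 ≤ D := integral_nonneg fun _ => by positivity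
  have h1 := hu.integral_rpow_le hp2.le (C := √(2 * (√(2 * lam) * √D)))
    fun x => Real.le_sqrt_of_sq_le (by simpa only [hm] using hu.norm_sq_le x)
  have h2 : √(2 * (√(2 * lam) * √D)) ^ (p - 2)
      = (2 * √(2 * lam)) ^ ((p - 2) / 2) * D ^ ((p - 2) / 4) := by
    rw [← mul_assoc, Real.sqrt_eq_rpow, ← Real.rpow_mul (by positivity),
      Real.mul_rpow (by positivity) (by positivity), Real.sqrt_eq_rpow D, ← Real.rpow_mul hD]
    ring_nf
  rw [h2, hm] at h1
  have h3 : θ / p * ∫ x, ‖u x‖ ^ p ≤ A * D ^ ((p - 2) / 4) := by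
    calc θ / p * ∫ x, ‖u x‖ ^ p
        ≤ θ / p * ((2 * √(2 * lam)) ^ ((p - 2) / 2) * D ^ ((p - 2) / 4) * (2 * lam)) := by gcongr
      _ = A * D ^ ((p - 2) / 4) := by rw [hA]; ring
  have h4 := hC D hD
  have h5 : 0 ≤ k / 4 * ∫ x, (2 * inner ℝ (u x) (g x)) ^ 2 :=
    mul_nonneg (by positivity) (integral_nonneg fun _ => by positivity)
  rw [hu.pairEnergy_eq hp2.le]
  linarith

theorem bddBelow_energy (hk : 0 ≤ k) (hθ : 0 < θ) (hlam : 0 < lam) (hp2 : 2 < p) (hp6 : p < 6) :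
    BddBelow (energy k θ p '' massSphere lam) := by
  obtain ⟨C, hC⟩ := exists_coercive hk hθ hlam hp2 hp6
  refine ⟨-C, ?_⟩
  rintro _ ⟨v, hv, rfl⟩
  obtain ⟨u, g, hu, huv, hm⟩ := exists_h1Pair_of_mem_massSphere hv
  rw [hu.energy_eq huv]
  have h1 := hC u g hu hm
  have h2 : 0 ≤ ∫ x, ‖g x‖ ^ 2 := integral_nonneg fun _ => by positivity
  linarith

theorem minEnergy_le (hb : BddBelow (energy k θ p '' massSphere lam)) (hu : H1Pair u g)
    (hm : ∫ x, ‖u x‖ ^ 2 = 2 * lam) : minEnergy k θ p lam ≤ pairEnergy k θ p u g := by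
  rw [← hu.energy_eq (ae_eq_refl u)]
  exact csInf_le hb ⟨u, hu.mem_massSphere (ae_eq_refl u) hm, rfl⟩

/-! ### Negativity of the infimum -/

theorem H1Pair.integral_sq_pos (hu : H1Pair u g) {x : ℝ} (hx : u x ≠ 0) : 0 < ∫ x, ‖u x‖ ^ 2 :=
  integral_pos_of_integrable_nonneg_nonzero (hu.continuous.norm.pow 2) hu.integrable_sq
    (fun _ => by positivity) (x := x) (by simpa using hx)

theorem H1Pair.integral_rpow_pos (hu : H1Pair u g) (hp : 2 ≤ p) {x : ℝ} (hx : u x ≠ 0) :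
    0 < ∫ x, ‖u x‖ ^ p :=
  integral_pos_of_integrable_nonneg_nonzero
    (hu.continuous.norm.rpow_const fun x => Or.inr (by linarith)) (hu.integrable_rpow hp)
    (fun _ => by positivity) (x := x) (Real.rpow_pos_of_pos (norm_pos_iff.mpr hx) _).ne'

theorem minEnergy_neg (hb : BddBelow (energy k θ p '' massSphere lam)) (hθ : 0 < θ)
    (hlam : 0 < lam) (hp2 : 2 < p) (hp6 : p < 6) : minEnergy k θ p lam < 0 := by
  obtain ⟨u, g, hu, h0⟩ := exists_h1Pair_pos
  have hM : 0 < ∫ x, ‖u x‖ ^ 2 := hu.integral_sq_pos h0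
  have hP : 0 < ∫ x, ‖u x‖ ^ p := hu.integral_rpow_pos hp2.le h0
  set κ := 2 * lam / ∫ x, ‖u x‖ ^ 2 with hκ
  have hκ0 : 0 < κ := by positivity
  -- `F s` is the energy of `√(κ s) u(s x)`, which has mass `2 * lam`, divided by `s ^ (p / 2 - 1)`.
  -- Both exponents of `s` are positive as `p < 6`, so only the potential term remains at `s = 0`.
  set F : ℝ → ℝ := fun s => 1 / 2 * (κ * ∫ x, ‖g x‖ ^ 2) * s ^ (3 - p / 2)
      + k / 4 * (κ ^ 2 * ∫ x, (2 * inner ℝ (u x) (g x)) ^ 2) * s ^ (4 - p / 2)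
      - θ / p * (κ ^ (p / 2) * ∫ x, ‖u x‖ ^ p) with hF
  have hcont : ContinuousAt F 0 := by
    refine ((continuousAt_const.mul ?_).add (continuousAt_const.mul ?_)).sub continuousAt_const
    · exact Real.continuousAt_rpow_const _ _ (Or.inr (by linarith))
    · exact Real.continuousAt_rpow_const _ _ (Or.inr (by linarith))
  have hF0 : F 0 < 0 := by
    simp only [hF]
    rw [Real.zero_rpow (by linarith), Real.zero_rpow (by linarith)]
    have : 0 < θ / p * (κ ^ (p / 2) * ∫ x, ‖u x‖ ^ p) := by positivity
    linarith
  have hev : ∀ᶠ s in 𝓝[>] (0 : ℝ), F s < 0 :=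
    (hcont.eventually (gt_mem_nhds hF0)).filter_mono nhdsWithin_le_nhds
  obtain ⟨s, hs, hs0⟩ := (hev.and self_mem_nhdsWithin).exists
  have hs0 : 0 < s := hs0
  have hc2 : √(κ * s) ^ 2 = κ * s := Real.sq_sqrt (by positivity)
  have hle := minEnergy_le hb (hu.comp_mul_add (√(κ * s)) hs0.ne' 0) (by
    rw [H1Pair.integral_sq_comp, hc2, abs_of_pos hs0, hκ]; field_simp)
  refine hle.trans_lt ?_
  rw [hu.pairEnergy_comp hp2.le _ hs0.ne' 0, abs_of_pos hs0, abs_of_nonneg (Real.sqrt_nonneg _),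
    show √(κ * s) ^ 4 = (√(κ * s) ^ 2) ^ 2 by ring, hc2, Real.sqrt_eq_rpow,
    ← Real.rpow_mul (by positivity), show 1 / 2 * p = p / 2 by ring,
    Real.mul_rpow hκ0.le hs0.le]
  have e1 : s ^ (p / 2 - 1) * s ^ (3 - p / 2) = s ^ 2 := by
    rw [← Real.rpow_add hs0, ← Real.rpow_natCast]; norm_num
  have e2 : s ^ (p / 2 - 1) * s ^ (4 - p / 2) = s ^ 3 := by
    rw [← Real.rpow_add hs0, ← Real.rpow_natCast]; norm_num
  have e3 : s ^ (p / 2) * s⁻¹ = s ^ (p / 2 - 1) := by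
    rw [Real.rpow_sub_one hs0.ne', ← div_eq_mul_inv]
  have key : s ^ (p / 2 - 1) * F s < 0 := mul_neg_of_pos_of_neg (by positivity) hs
  refine lt_of_eq_of_lt ?_ key
  simp only [hF]
  linear_combination (-1 / 2 * (κ * ∫ x, ‖g x‖ ^ 2)) * e1
    - (k / 4 * (κ ^ 2 * ∫ x, (2 * inner ℝ (u x) (g x)) ^ 2)) * e2
    - (θ / p * (κ ^ (p / 2) * ∫ x, ‖u x‖ ^ p)) * e3

/-! ### Scaling and the sign of the action -/

/-- Test the infimum with `u (x / t)`: the amplitude is unchanged, so both gradient terms scale by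
the same factor `t⁻¹`. -/
theorem minEnergy_le_scaled (hb : BddBelow (energy k θ p '' massSphere lam)) (hp : 2 ≤ p)
    (hu : H1Pair u g) {t : ℝ} (ht : 0 < t) (hm : t * ∫ x, ‖u x‖ ^ 2 = 2 * lam) :
    minEnergy k θ p lam ≤ t⁻¹ * (1 / 2 * (∫ x, ‖g x‖ ^ 2)
      + k / 4 * ∫ x, (2 * inner ℝ (u x) (g x)) ^ 2) - t * (θ / p * ∫ x, ‖u x‖ ^ p) := by
  have ht' := inv_pos.mpr ht
  have h1 := minEnergy_le hb (hu.comp_mul_add 1 ht'.ne' 0)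
    (by rw [H1Pair.integral_sq_comp, abs_of_pos ht', inv_inv, one_pow, one_mul, hm])
  rw [hu.pairEnergy_comp hp 1 ht'.ne' 0, abs_of_pos ht', inv_inv] at h1
  simp only [one_pow, one_mul, abs_one, Real.one_rpow] at h1
  linarith

/-- The density of the action `I(u) - ν ∫ |u|²`. -/
def actionDensity (k θ p ν : ℝ) (a b : ℂ) : ℝ := density k θ p a b - ν * ‖a‖ ^ 2

theorem H1Pair.integrable_actionDensity (hu : H1Pair u g) (hp : 2 ≤ p) (ν : ℝ) :
    Integrable (fun x => actionDensity k θ p ν (u x) (g x)) :=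
  (hu.integrable_density hp).sub (hu.integrable_sq.const_mul ν)

theorem H1Pair.integral_actionDensity (hu : H1Pair u g) (hp : 2 ≤ p) (ν : ℝ) :
    ∫ x, actionDensity k θ p ν (u x) (g x) = pairEnergy k θ p u g - ν * ∫ x, ‖u x‖ ^ 2 := by
  unfold actionDensity
  rw [integral_sub (hu.integrable_density hp) (hu.integrable_sq.const_mul ν), integral_const_mul,
    pairEnergy]

theorem H1Pair.kinetic_nonneg (hk : 0 ≤ k) (u g : ℝ → ℂ) :
    0 ≤ 1 / 2 * (∫ x, ‖g x‖ ^ 2) + k / 4 * ∫ x, (2 * inner ℝ (u x) (g x)) ^ 2 :=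
  add_nonneg (mul_nonneg (by norm_num) (integral_nonneg fun _ => by positivity))
    (mul_nonneg (by positivity) (integral_nonneg fun _ => by positivity))

/-- With `t = 2 * lam / M ≥ 1`, `K` the gradient part and `P` the potential part, `m ≤ K / t - t P ≤
t (K - P)`; dividing by `t` gives `K - P ≥ m / t = ν M`. -/
theorem action_nonneg (hb : BddBelow (energy k θ p '' massSphere lam)) (hk : 0 ≤ k) (hθ : 0 < θ)
    (hlam : 0 < lam) (hp : 2 < p) (hu : H1Pair u g) (hm : ∫ x, ‖u x‖ ^ 2 ≤ 2 * lam) :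
    0 ≤ ∫ x, actionDensity k θ p (minEnergy k θ p lam / (2 * lam)) (u x) (g x) := by
  rw [hu.integral_actionDensity hp.le]
  have hK := H1Pair.kinetic_nonneg hk u g
  have hM : 0 ≤ ∫ x, ‖u x‖ ^ 2 := integral_nonneg fun _ => by positivity
  rw [hu.pairEnergy_eq hp.le]
  rcases hM.eq_or_lt with h0 | hpos
  · obtain ⟨C, -, hC⟩ := hu.exists_bound
    have h1 := hu.integral_rpow_le hp.le hC
    rw [← h0, mul_zero] at h1 ⊢
    have h2 : θ / p * ∫ x, ‖u x‖ ^ p ≤ 0 :=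
      mul_nonpos_of_nonneg_of_nonpos (by positivity) h1
    linarith
  · set M := ∫ x, ‖u x‖ ^ 2
    set t := 2 * lam / M with ht
    have ht0 : 0 < t := by positivity
    have ht1 : 1 ≤ t := (one_le_div hpos).mpr hm
    have h1 := minEnergy_le_scaled hb hp.le hu ht0 (div_mul_cancel₀ _ hpos.ne')
    set K := 1 / 2 * (∫ x, ‖g x‖ ^ 2) + k / 4 * ∫ x, (2 * inner ℝ (u x) (g x)) ^ 2
    set P := θ / p * ∫ x, ‖u x‖ ^ p
    have h2 : t⁻¹ * K ≤ t * K := by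
      gcongr
      exact (inv_le_one_of_one_le₀ ht1).trans ht1
    have h3 : minEnergy k θ p lam / (2 * lam) * M = minEnergy k θ p lam / t := by
      rw [ht]; field_simp
    rw [h3, sub_nonneg, div_le_iff₀ ht0]
    linarith

/-- If the action of `u` is nonpositive and `u` is not constant, then `u` carries the whole mass. -/
theorem le_mass_of_action_nonpos (hb : BddBelow (energy k θ p '' massSphere lam)) (hk : 0 ≤ k)
    (hlam : 0 < lam) (hp : 2 < p) (hu : H1Pair u g) (hpos : 0 < ∫ x, ‖u x‖ ^ 2)
    (hD : 0 < ∫ x, ‖g x‖ ^ 2)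
    (hJ : ∫ x, actionDensity k θ p (minEnergy k θ p lam / (2 * lam)) (u x) (g x) ≤ 0) :
    2 * lam ≤ ∫ x, ‖u x‖ ^ 2 := by
  by_contra! hlt
  rw [hu.integral_actionDensity hp.le, hu.pairEnergy_eq hp.le] at hJ
  set M := ∫ x, ‖u x‖ ^ 2
  set t := 2 * lam / M with ht
  have ht0 : 0 < t := by positivity
  have ht1 : 1 < t := (one_lt_div hpos).mpr hlt
  have h1 := minEnergy_le_scaled hb hp.le hu ht0 (div_mul_cancel₀ _ hpos.ne')
  have hK : 0 < 1 / 2 * (∫ x, ‖g x‖ ^ 2) + k / 4 * ∫ x, (2 * inner ℝ (u x) (g x)) ^ 2 :=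
    add_pos_of_pos_of_nonneg (by positivity)
      (mul_nonneg (by positivity) (integral_nonneg fun _ => by positivity))
  set K := 1 / 2 * (∫ x, ‖g x‖ ^ 2) + k / 4 * ∫ x, (2 * inner ℝ (u x) (g x)) ^ 2
  set P := θ / p * ∫ x, ‖u x‖ ^ p
  -- Missing mass means `t > 1`, which makes the comparison strict and contradicts `hJ`.
  have h2 : t⁻¹ * K < t * K := by
    gcongr
    exact (inv_lt_one_of_one_lt₀ ht1).trans ht1
  have h3 : minEnergy k θ p lam / (2 * lam) * M = minEnergy k θ p lam / t := by
    rw [ht]; field_simp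
  rw [h3, sub_nonpos, le_div_iff₀ ht0] at hJ
  linarith

/-- The action on a half-line is bounded below by the boundary value. -/
theorem action_Ioi_ge (hb : BddBelow (energy k θ p '' massSphere lam)) (hk : 0 ≤ k) (hθ : 0 < θ)
    (hlam : 0 < lam) (hp : 2 < p) (hneg : minEnergy k θ p lam ≤ 0) (hu : H1Pair u g) {B R : ℝ}
    (hB : ‖u R‖ ≤ B) (hm : (∫ x in Set.Ioi R, ‖u x‖ ^ 2) + ‖u R‖ ^ 2 / 2 ≤ 2 * lam) :
    -((1 / 2 + k * B ^ 2 - minEnergy k θ p lam / (2 * lam)) * (‖u R‖ ^ 2 / 2)) ≤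
      ∫ x in Set.Ioi R, actionDensity k θ p (minEnergy k θ p lam / (2 * lam)) (u x) (g x) := by
  set ν := minEnergy k θ p lam / (2 * lam)
  have hν : ν ≤ 0 := div_nonpos_of_nonpos_of_nonneg hneg (by positivity)
  -- The extended function has mass at most `2 * lam`, hence nonnegative action; it remains to bound
  -- the share of the exponential tail from above.
  have hw := h1Pair_expExtend hu.isPrimitive R (hu.memLp.restrict _) (hu.memLp_deriv.restrict _)
  have hE : ∀ f x, x ∈ Set.Iic R → expExtend R u f x = Real.exp (x - R) • u R := fun f x hx =>
    if_pos hx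
  have hI : ∀ f x, x ∈ Set.Ioi R → expExtend R u f x = f x := fun f x hx => if_neg (not_le.mpr hx)
  have hmass : ∫ x, ‖expExtend R u u x‖ ^ 2 ≤ 2 * lam := by
    rw [← intervalIntegral.integral_Iic_add_Ioi hw.integrable_sq.integrableOn
      hw.integrable_sq.integrableOn]
    rw [setIntegral_congr_fun (g := fun x => ‖Real.exp (x - R) • u R‖ ^ 2) measurableSet_Iic
        fun x hx => by simp only [hE u x hx],
      setIntegral_congr_fun (g := fun x => ‖u x‖ ^ 2) measurableSet_Ioi
        fun x hx => by simp only [hI u x hx], integral_exp_smul_sq]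
    linarith
  have hJ := action_nonneg hb hk hθ hlam hp hw hmass
  have hint := hw.integrable_actionDensity (k := k) (θ := θ) hp.le ν
  rw [← intervalIntegral.integral_Iic_add_Ioi hint.integrableOn hint.integrableOn,
    setIntegral_congr_fun (s := Set.Ioi R) (g := fun x => actionDensity k θ p ν (u x) (g x))
      measurableSet_Ioi fun x hx => by simp only [hI u x hx, hI g x hx]] at hJ
  have hle : ∫ x in Set.Iic R, actionDensity k θ p ν (expExtend R u u x) (expExtend R u g x)
      ≤ (1 / 2 + k * B ^ 2 - ν) * (‖u R‖ ^ 2 / 2) := by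
    rw [← integral_exp_smul_sq, ← integral_const_mul]
    refine setIntegral_mono_on hint.integrableOn
      ((integrableOn_exp_smul_sq _ _).const_mul _) measurableSet_Iic fun x hx => ?_
    rw [hE u x hx, hE g x hx, actionDensity, density, real_inner_self_eq_norm_sq]
    set a := ‖Real.exp (x - R) • u R‖ with ha
    have ha0 : 0 ≤ a := norm_nonneg _
    have haB : a ≤ B := by
      rw [ha, norm_smul, Real.norm_of_nonneg (Real.exp_pos _).le]
      have : Real.exp (x - R) ≤ 1 := Real.exp_le_one_iff.mpr (sub_nonpos.mpr hx)
      nlinarith [norm_nonneg (u R)]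
    -- On the tail value and slope coincide, so the density is `a² / 2 + k a⁴` minus the potential
    -- and `ν a²`; one factor `a²` is bounded by `B²`.
    have h1 : 0 ≤ θ / p * a ^ p := by positivity
    have h2 : k * a ^ 2 * a ^ 2 ≤ k * B ^ 2 * a ^ 2 := by gcongr
    nlinarith
  linarith

/-- Reflection `x ↦ -x` flips the sign of the slope, which enters the density only through even
terms. -/
theorem action_Iic_ge (hb : BddBelow (energy k θ p '' massSphere lam)) (hk : 0 ≤ k) (hθ : 0 < θ)
    (hlam : 0 < lam) (hp : 2 < p) (hneg : minEnergy k θ p lam ≤ 0) (hu : H1Pair u g) {B R : ℝ}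
    (hB : ‖u R‖ ≤ B) (hm : (∫ x in Set.Iic R, ‖u x‖ ^ 2) + ‖u R‖ ^ 2 / 2 ≤ 2 * lam) :
    -((1 / 2 + k * B ^ 2 - minEnergy k θ p lam / (2 * lam)) * (‖u R‖ ^ 2 / 2)) ≤
      ∫ x in Set.Iic R, actionDensity k θ p (minEnergy k θ p lam / (2 * lam)) (u x) (g x) := by
  have h := action_Ioi_ge hb hk hθ hlam hp hneg hu.reflect (B := B) (R := -R)
    (by simpa using hB) (by
      rw [integral_comp_neg_Ioi (-R) (fun x => ‖u x‖ ^ 2)]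
      simpa using hm)
  have hsymm : ∀ x, actionDensity k θ p (minEnergy k θ p lam / (2 * lam)) (u (-x)) (-g (-x))
      = (fun x => actionDensity k θ p (minEnergy k θ p lam / (2 * lam)) (u x) (g x)) (-x) := by
    intro x
    simp only [actionDensity, density, inner_neg_right, norm_neg, mul_neg, neg_sq]
  rw [funext hsymm, integral_comp_neg_Ioi (-R)
    (fun x => actionDensity k θ p (minEnergy k θ p lam / (2 * lam)) (u x) (g x))] at h
  simpa using h

end Bounds

/-! ### Limit theorems, weak compactness and lower semicontinuity. -/

section Limits

/-! ### Convergence of integrals -/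

theorem integrable_and_integral_le_of_tendsto {f : ℕ → ℝ → ℝ} {F : ℝ → ℝ} {C : ℝ}
    (hf : ∀ n, Integrable (f n)) (hf0 : ∀ n x, 0 ≤ f n x)
    (hlim : ∀ᵐ x, Tendsto (fun n => f n x) atTop (𝓝 (F x))) (hC : ∀ n, ∫ x, f n x ≤ C) :
    Integrable F ∧ ∫ x, F x ≤ C := by
  have hF0 : 0 ≤ᵐ[volume] F := by
    filter_upwards [hlim] with x hx
    exact ge_of_tendsto' hx fun n => hf0 n x
  have hm : AEStronglyMeasurable F volume :=
    aestronglyMeasurable_of_tendsto_ae atTop (fun n => (hf n).1) hlim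
  have hC0 : 0 ≤ C := (integral_nonneg (hf0 0)).trans (hC 0)
  have hle : ∫⁻ x, ENNReal.ofReal (F x) ≤ ENNReal.ofReal C := by
    calc ∫⁻ x, ENNReal.ofReal (F x)
        = ∫⁻ x, liminf (fun n => ENNReal.ofReal (f n x)) atTop := by
          refine lintegral_congr_ae ?_
          filter_upwards [hlim] with x hx
          exact ((ENNReal.continuous_ofReal.tendsto _).comp hx).liminf_eq.symm
      _ ≤ liminf (fun n => ∫⁻ x, ENNReal.ofReal (f n x)) atTop :=
          lintegral_liminf_le' fun n => (hf n).1.aemeasurable.ennreal_ofReal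
      _ ≤ ENNReal.ofReal C := by
          refine liminf_le_of_frequently_le' (Frequently.of_forall fun n => ?_)
          rw [← ofReal_integral_eq_lintegral_ofReal (hf n) (Eventually.of_forall (hf0 n))]
          exact ENNReal.ofReal_le_ofReal (hC n)
  have hint : Integrable F := by
    refine ⟨hm, ?_⟩
    rw [hasFiniteIntegral_iff_ofReal hF0]
    exact hle.trans_lt ENNReal.ofReal_lt_top
  refine ⟨hint, ?_⟩
  rw [integral_eq_lintegral_of_nonneg_ae hF0 hm]
  exact ENNReal.toReal_le_of_le_ofReal hC0 hle

/-- Dominated convergence with a convergent sequence of bounds. -/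
theorem tendsto_integral_of_tendsto_bounds {f G : ℕ → ℝ → ℝ} {F H : ℝ → ℝ}
    (hf : ∀ n, Integrable (f n)) (hF : Integrable F) (hG : ∀ n, Integrable (G n))
    (hH : Integrable H) (hle : ∀ n x, |f n x| ≤ G n x)
    (hlim : ∀ x, Tendsto (fun n => f n x) atTop (𝓝 (F x)))
    (hGlim : ∀ x, Tendsto (fun n => G n x) atTop (𝓝 (H x)))
    (hint : Tendsto (fun n => ∫ x, G n x) atTop (𝓝 (∫ x, H x))) :
    Tendsto (fun n => ∫ x, f n x) atTop (𝓝 (∫ x, F x)) := by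
  have hFH : ∀ x, |F x| ≤ H x := fun x =>
    le_of_tendsto_of_tendsto' (hlim x).abs (hGlim x) fun n => hle n x
  have key : Tendsto (fun n => ∫ x, |f n x - F x|) atTop (𝓝 0) := by
    rw [tendsto_order]
    refine ⟨fun a ha => Eventually.of_forall fun n =>
      ha.trans_le (integral_nonneg fun x => abs_nonneg _), fun ε hε => ?_⟩
    by_contra hcon
    have hfr : ∃ᶠ n in atTop, ε ≤ ∫ x, |f n x - F x| := by
      simpa only [Filter.Frequently, not_le] using hcon
    have hev : ∀ᶠ n in atTop, ∫ x, G n x ≤ (∫ x, H x) + ε / 2 :=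
      (hint.eventually (gt_mem_nhds (by linarith))).mono fun n hn => le_of_lt hn
    obtain ⟨φ, hφ, hφ'⟩ := extraction_of_frequently_atTop (hfr.and_eventually hev)
    have hi : ∀ n, Integrable (fun x => |f n x - F x|) := fun n => ((hf n).sub hF).abs
    -- Fatou for the nonnegative functions `G + H - |f - F|`, along a subsequence on which `∫ |f -
    -- F| ≥ ε`, would give `2 ∫ H ≤ 2 ∫ H - ε / 2`.
    have h1 := integrable_and_integral_le_of_tendsto
      (f := fun n x => G (φ n) x + H x - |f (φ n) x - F x|) (F := fun x => H x + H x - |F x - F x|)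
      (C := (∫ x, H x) + ε / 2 + (∫ x, H x) - ε)
      (fun n => ((hG _).add hH).sub (hi _))
      (fun n x => by
        have h1 := hle (φ n) x
        have h2 := hFH x
        have h3 := abs_sub (f (φ n) x) (F x)
        linarith)
      (Eventually.of_forall fun x => (((hGlim x).comp hφ.tendsto_atTop).add_const _).sub
        (((hlim x).comp hφ.tendsto_atTop).sub_const _).abs)
      (fun n => by
        rw [integral_sub ((hG _).fun_add hH) (hi _), integral_add (hG _) hH]
        linarith [(hφ' n).1, (hφ' n).2])
    have h2 := h1.2
    simp only [sub_self, abs_zero, sub_zero] at h2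
    rw [integral_add hH hH] at h2
    linarith
  rw [tendsto_iff_dist_tendsto_zero]
  refine squeeze_zero (fun _ => dist_nonneg) (fun n => ?_) key
  rw [Real.dist_eq, ← integral_sub (hf n) hF]
  exact abs_integral_le_integral_abs

/-! ### Weak compactness -/

theorem integrable_inner_of_memLp {h g : ℝ → ℂ} {μ : Measure ℝ} (hh : MemLp h 2 μ)
    (hg : MemLp g 2 μ) : Integrable (fun x => inner ℝ (h x) (g x)) μ :=
  (integrable_mul_norm hh hg).mono' (hh.1.inner hg.1)
    (Eventually.of_forall fun _ => norm_inner_le_norm _ _)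

/-- Bounded sequences in `L²` have weakly convergent subsequences. -/
theorem exists_weak_subseq {g : ℕ → ℝ → ℂ} (hg : ∀ n, MemLp (g n) 2 volume) {D : ℝ}
    (hD : ∀ n, ∫ x, ‖g n x‖ ^ 2 ≤ D) :
    ∃ (φ : ℕ → ℕ) (G : ℝ → ℂ), StrictMono φ ∧ MemLp G 2 volume ∧
      ∀ h, MemLp h 2 volume →
        Tendsto (fun n => ∫ x, inner ℝ (h x) (g (φ n) x)) atTop (𝓝 (∫ x, inner ℝ (h x) (G x))) := by
  have : Fact ((2 : ENNReal) ≠ ⊤) := ⟨by simp⟩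
  let H := Lp ℂ 2 (volume : Measure ℝ)
  have hinner : ∀ {a b : ℝ → ℂ} (ha : MemLp a 2 volume) (hb : MemLp b 2 volume),
      inner ℝ (ha.toLp a : H) (hb.toLp b) = ∫ x, inner ℝ (a x) (b x) := fun ha hb => by
    rw [L2.inner_def]
    refine integral_congr_ae ?_
    filter_upwards [ha.coeFn_toLp, hb.coeFn_toLp] with x h1 h2
    rw [h1, h2]
  have hnorm : ∀ n, ‖((hg n).toLp (g n) : H)‖ ≤ √D := fun n => by
    refine Real.le_sqrt_of_sq_le ?_
    rw [← real_inner_self_eq_norm_sq, hinner]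
    simpa only [real_inner_self_eq_norm_sq] using hD n
  -- Riesz identifies `L²` with its dual, where sequential Banach-Alaoglu applies.
  let T : ℕ → WeakDual ℝ H := fun n =>
    WeakDual.toStrongDual.symm (InnerProductSpace.toDual ℝ H ((hg n).toLp (g n)))
  obtain ⟨ℓ, -, φ, hφ, hlim⟩ := WeakDual.isSeqCompact_closedBall ℝ H 0 √D (x := T) (fun n => by
    rw [Set.mem_preimage, mem_closedBall_zero_iff]
    simpa only [T, LinearEquiv.apply_symm_apply, LinearIsometryEquiv.norm_map] using hnorm n)
  let G : H := (InnerProductSpace.toDual ℝ H).symm (WeakDual.toStrongDual ℓ)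
  refine ⟨φ, G, hφ, Lp.memLp G, fun h hh => ?_⟩
  have h1 := (WeakDual.eval_continuous (𝕜 := ℝ) (hh.toLp h : H)).continuousAt.tendsto.comp hlim
  have h2 : ∀ n, (T n) (hh.toLp h) = ∫ x, inner ℝ (h x) (g n x) := fun n => by
    rw [← hinner hh (hg n), real_inner_comm]
    rfl
  have h3 : ℓ (hh.toLp h) = ∫ x, inner ℝ (h x) (G x) := by
    rw [← hinner hh (Lp.memLp G), real_inner_comm, Lp.toLp_coeFn]
    exact (InnerProductSpace.toDual_symm_apply (𝕜 := ℝ) (E := H) (y := WeakDual.toStrongDual ℓ)).symm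
  rw [← h3]
  refine h1.congr fun n => h2 (φ n)

/-- Weak convergence of bounded sequences of pairs: the values converge pointwise and the
derivatives converge weakly in `L²`. -/
structure WeakLimit (v G : ℕ → ℝ → ℂ) (w g : ℝ → ℂ) (B D : ℝ) : Prop where
  pair : ∀ n, H1Pair (v n) (G n)
  pair_limit : H1Pair w g
  bound : ∀ n x, ‖v n x‖ ≤ B
  bound_deriv : ∀ n, ∫ x, ‖G n x‖ ^ 2 ≤ D
  tendsto : ∀ x, Tendsto (fun n => v n x) atTop (𝓝 (w x))
  weak : ∀ h, MemLp h 2 volume →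
    Tendsto (fun n => ∫ x, inner ℝ (h x) (G n x)) atTop (𝓝 (∫ x, inner ℝ (h x) (g x)))

theorem tendsto_complex_of_inner {z : ℕ → ℂ} {c : ℂ}
    (h : ∀ a : ℂ, Tendsto (fun n => inner ℝ a (z n)) atTop (𝓝 (inner ℝ a c))) :
    Tendsto z atTop (𝓝 c) := by
  have h1 := (Complex.continuous_ofReal.tendsto _).comp (h 1)
  have h2 := ((Complex.continuous_ofReal.tendsto _).comp (h Complex.I)).mul_const Complex.I
  have h3 : ∀ z : ℂ, ((inner ℝ (1 : ℂ) z : ℝ) : ℂ) + ((inner ℝ Complex.I z : ℝ) : ℂ) * Complex.I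
      = z := fun z => by
    simp only [Complex.inner]
    apply Complex.ext <;> simp
  have h4 := h1.add h2
  rw [h3] at h4
  exact h4.congr fun n => h3 (z n)

/-- Writes an interval integral as a pairing with an `L²` indicator, so that weak convergence
applies; the sign accounts for orientation. -/
theorem inner_intervalIntegral {g : ℝ → ℂ} (hg : MemLp g 2 volume) (a : ℂ) (s t : ℝ) :
    inner ℝ a (∫ x in s..t, g x)
      = (if s ≤ t then 1 else -1) * ∫ x, inner ℝ ((Set.uIoc s t).indicator (fun _ => a) x) (g x) := by
  have h1 : ∀ x, inner ℝ ((Set.uIoc s t).indicator (fun _ => a) x) (g x)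
      = (Set.uIoc s t).indicator (fun x => inner ℝ a (g x)) x := fun x => by
    by_cases hx : x ∈ Set.uIoc s t <;> simp [hx]
  have h2 : IntegrableOn g (Set.uIoc s t) := by
    have := (hg.locallyIntegrable (by norm_num)).intervalIntegrable_real s t
    exact intervalIntegrable_iff.mp this
  simp only [h1]
  rw [integral_indicator measurableSet_uIoc, integral_inner h2,
    intervalIntegral.intervalIntegral_eq_integral_uIoc, inner_smul_right]

/-- Extract a weak limit of the derivatives and a limit of the values at 0; integrating from 0
yields convergence at every point, and Fatou bounds the mass. -/
theorem exists_weakLimit {v G : ℕ → ℝ → ℂ} (hv : ∀ n, H1Pair (v n) (G n)) {M D : ℝ}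
    (hM : ∀ n, ∫ x, ‖v n x‖ ^ 2 ≤ M) (hD : ∀ n, ∫ x, ‖G n x‖ ^ 2 ≤ D) :
    ∃ (φ : ℕ → ℕ) (w g : ℝ → ℂ) (B : ℝ), StrictMono φ ∧
      WeakLimit (fun n => v (φ n)) (fun n => G (φ n)) w g B D ∧ ∫ x, ‖w x‖ ^ 2 ≤ M := by
  set B := √(2 * (√M * √D))
  have hB : ∀ n x, ‖v n x‖ ≤ B := fun n x => by
    refine Real.le_sqrt_of_sq_le (((hv n).norm_sq_le x).trans ?_)
    gcongr
    · exact hM n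
    · exact hD n
  obtain ⟨φ₁, g, hφ₁, hg, hweak⟩ := exists_weak_subseq (fun n => (hv n).memLp_deriv) hD
  obtain ⟨c, -, φ₂, hφ₂, hc⟩ := tendsto_subseq_of_bounded (Metric.isBounded_closedBall (x := (0 : ℂ))
    (r := B)) (x := fun n => v (φ₁ n) 0) (fun n => by simpa using hB (φ₁ n) 0)
  have hweak' : ∀ h, MemLp h 2 volume → Tendsto (fun n => ∫ x, inner ℝ (h x) (G (φ₁ (φ₂ n)) x)) atTop
      (𝓝 (∫ x, inner ℝ (h x) (g x))) := fun h hh => (hweak h hh).comp hφ₂.tendsto_atTop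
  have hpt : ∀ x, Tendsto (fun n => v (φ₁ (φ₂ n)) x) atTop (𝓝 (c + ∫ t in (0 : ℝ)..x, g t)) := by
    intro x
    have h1 : Tendsto (fun n => ∫ t in (0 : ℝ)..x, G (φ₁ (φ₂ n)) t) atTop
        (𝓝 (∫ t in (0 : ℝ)..x, g t)) := by
      refine tendsto_complex_of_inner fun a => ?_
      simp only [inner_intervalIntegral hg, inner_intervalIntegral (hv _).memLp_deriv]
      refine (hweak' _ ?_).const_mul _
      exact memLp_indicator_const 2 measurableSet_uIoc a (Or.inr (by simp [Set.uIoc]))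
    refine (hc.add h1).congr fun n => ?_
    simp only [Function.comp_apply]
    rw [← (hv _).sub_eq]
    abel
  have hp := isPrimitive_integral (hg.locallyIntegrable (by norm_num)) 0
  have hwc : Continuous fun x => c + ∫ t in (0 : ℝ)..x, g t := continuous_const.add hp.continuous
  obtain ⟨hw2, hwM⟩ := integrable_and_integral_le_of_tendsto (fun n => (hv (φ₁ (φ₂ n))).integrable_sq)
    (fun n x => by positivity) (Eventually.of_forall fun x => (hpt x).norm.pow 2)
    (fun n => hM (φ₁ (φ₂ n)))
  refine ⟨φ₁ ∘ φ₂, fun x => c + ∫ t in (0 : ℝ)..x, g t, g, B, hφ₁.comp hφ₂,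
    ⟨fun n => hv _, ⟨?_, hg, fun a b => ?_⟩, fun n => hB _, fun n => hD _, hpt, hweak'⟩, hwM⟩
  · exact (memLp_two_iff_integrable_sq_norm hwc.aestronglyMeasurable).mpr hw2
  · rw [← hp.sub_eq a b]
    abel

/-! ### Semicontinuity -/

/-- The kinetic part of the energy density. -/
def kineticDensity (k : ℝ) (a b : ℂ) : ℝ := 1 / 2 * ‖b‖ ^ 2 + k / 4 * (2 * inner ℝ a b) ^ 2

namespace H1Pair

variable {u g : ℝ → ℂ} {k : ℝ}

theorem integrable_kineticDensity (hu : H1Pair u g) :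
    Integrable (fun x => kineticDensity k (u x) (g x)) :=
  (hu.integrable_deriv_sq.const_mul _).add (hu.integrable_inner_sq.const_mul _)

end H1Pair

namespace WeakLimit

variable {v G : ℕ → ℝ → ℂ} {w g : ℝ → ℂ} {B D k θ p lam : ℝ}

theorem bound_limit (h : WeakLimit v G w g B D) (x : ℝ) : ‖w x‖ ≤ B :=
  le_of_tendsto' (h.tendsto x).norm fun n => h.bound n x

/-- Strong times weak: `h v_n → h w` in `L²` by dominated convergence, while `G_n` is bounded and
converges weakly. -/
theorem tendsto_integral_inner (hW : WeakLimit v G w g B D) {h : ℝ → ℝ} (hh : MemLp h 2 volume) :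
    Tendsto (fun n => ∫ x, h x * (2 * inner ℝ (v n x) (G n x))) atTop
      (𝓝 (∫ x, h x * (2 * inner ℝ (w x) (g x)))) := by
  have hmem : ∀ {u g}, H1Pair u g → MemLp (fun x => h x • u x) 2 volume := fun {u g} hu => by
    obtain ⟨C, hC0, hC⟩ := hu.exists_bound
    refine MemLp.of_le_mul (c := C) hh (hh.1.smul hu.continuous.aestronglyMeasurable)
      (Eventually.of_forall fun x => ?_)
    rw [norm_smul, mul_comm]
    gcongr
    exact hC x
  have hdiff : ∀ n, MemLp (fun x => h x • (v n x - w x)) 2 volume := fun n =>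
    hmem ((hW.pair n).sub hW.pair_limit)
  have h0 : Tendsto (fun n => ∫ x, ‖h x • (v n x - w x)‖ ^ 2) atTop (𝓝 0) := by
    have := tendsto_integral_of_dominated_convergence (μ := volume)
      (F := fun n x => ‖h x • (v n x - w x)‖ ^ 2) (f := fun _ => (0 : ℝ))
      (fun x => (2 * B) ^ 2 * h x ^ 2) (fun n => ((hdiff n).1.norm.pow 2))
      (hh.integrable_sq.const_mul _) (fun n => Eventually.of_forall fun x => ?_)
      (Eventually.of_forall fun x => ?_)
    · simpa using this
    · rw [Real.norm_of_nonneg (by positivity), norm_smul, mul_pow, Real.norm_eq_abs, sq_abs, mul_comm]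
      have h1 : ‖v n x - w x‖ ≤ 2 * B := by
        linarith [norm_sub_le (v n x) (w x), hW.bound n x, hW.bound_limit x]
      gcongr
    · have h1 : Tendsto (fun n => h x • (v n x - w x)) atTop (𝓝 0) := by
        simpa using ((hW.tendsto x).sub_const (w x)).const_smul (h x)
      simpa using h1.norm.pow 2
  have h1 : Tendsto (fun n => ∫ x, inner ℝ (h x • (v n x - w x)) (G n x)) atTop (𝓝 0) := by
    refine squeeze_zero_norm (a := fun n => √(∫ x, ‖h x • (v n x - w x)‖ ^ 2) * √D) (fun n => ?_) ?_
    · have h2 := (integral_mul_norm_le (hdiff n) (hW.pair n).memLp_deriv)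
      refine (norm_integral_le_integral_norm _).trans ?_
      refine (integral_mono_of_nonneg (Eventually.of_forall fun _ => norm_nonneg _)
        (integrable_mul_norm (hdiff n) (hW.pair n).memLp_deriv)
        (Eventually.of_forall fun x => norm_inner_le_norm _ _)).trans (h2.trans ?_)
      gcongr
      exact hW.bound_deriv n
    · simpa using (h0.sqrt).mul_const √D
  have h2 := (h1.add (hW.weak _ (hmem hW.pair_limit))).const_mul 2
  rw [zero_add, ← integral_const_mul] at h2
  refine Tendsto.congr (fun n => ?_) (h2.trans (le_of_eq ?_))
  · rw [← integral_add (integrable_inner_of_memLp (hdiff n) (hW.pair n).memLp_deriv)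
      (integrable_inner_of_memLp (hmem hW.pair_limit) (hW.pair n).memLp_deriv), ← integral_const_mul]
    congr 1
    ext x
    simp only [real_inner_smul_left, inner_sub_left]
    ring
  · congr 2
    ext x
    simp only [real_inner_smul_left]
    ring

/-- Quantitative weak lower semicontinuity of the kinetic energy on a measurable set. -/
theorem exists_kinetic_ge (hW : WeakLimit v G w g B D) (hk : 0 ≤ k) {A : Set ℝ}
    (hA : MeasurableSet A) :
    ∃ e : ℕ → ℝ, Tendsto e atTop (𝓝 0) ∧ ∀ n,
      1 / 2 * (∫ x in A, ‖G n x - g x‖ ^ 2) + (∫ x in A, kineticDensity k (w x) (g x)) + e n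
        ≤ ∫ x in A, kineticDensity k (v n x) (G n x) := by
  set q : ℝ → ℝ := fun x => 2 * inner ℝ (w x) (g x)
  have hq : MemLp q 2 volume := hW.pair_limit.memLp_inner
  have hqn : ∀ n, MemLp (fun x => 2 * inner ℝ (v n x) (G n x)) 2 volume := fun n =>
    (hW.pair n).memLp_inner
  have hg := hW.pair_limit.memLp_deriv
  have hG := fun n => (hW.pair n).memLp_deriv
  have hi : ∀ f : ℝ → ℂ, (fun x => inner ℝ (A.indicator g x) (f x))
      = A.indicator fun x => inner ℝ (g x) (f x) := fun f => by
    ext x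
    by_cases hx : x ∈ A <;> simp [hx]
  have hi' : ∀ f : ℝ → ℝ, (fun x => A.indicator q x * f x) = A.indicator fun x => q x * f x :=
    fun f => by
      ext x
      by_cases hx : x ∈ A <;> simp [hx]
  have h1 := hW.weak _ (hg.indicator hA)
  have h2 := hW.tendsto_integral_inner (hq.indicator hA)
  simp only [hi, hi', integral_indicator hA] at h1 h2
  have I1 : ∀ n, IntegrableOn (fun x => inner ℝ (g x) (G n x)) A := fun n =>
    (integrable_inner_of_memLp hg (hG n)).integrableOn
  have I2 : IntegrableOn (fun x => inner ℝ (g x) (g x)) A :=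
    (integrable_inner_of_memLp hg hg).integrableOn
  have I3 : ∀ n, IntegrableOn (fun x => q x * (2 * inner ℝ (v n x) (G n x))) A := fun n =>
    (hq.integrable_mul (hqn n)).integrableOn
  have I4 : IntegrableOn (fun x => q x * (2 * inner ℝ (w x) (g x))) A :=
    (hq.integrable_mul hq).integrableOn
  have I5 : ∀ n, IntegrableOn (fun x => ‖G n x - g x‖ ^ 2) A := fun n =>
    ((hW.pair n).sub hW.pair_limit).integrable_deriv_sq.integrableOn
  have I6 : IntegrableOn (fun x => kineticDensity k (w x) (g x)) A :=
    hW.pair_limit.integrable_kineticDensity.integrableOn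
  -- Expand both squares around the limit: the linear terms form `e n` and vanish by weak
  -- convergence; the square `‖G n - g‖²` is kept, the quasilinear one dropped.
  refine ⟨fun n => ((∫ x in A, inner ℝ (g x) (G n x)) - ∫ x in A, inner ℝ (g x) (g x))
    + k / 2 * ((∫ x in A, q x * (2 * inner ℝ (v n x) (G n x)))
      - ∫ x in A, q x * (2 * inner ℝ (w x) (g x))), ?_, fun n => ?_⟩
  · have h3 := (h1.sub_const (∫ x in A, inner ℝ (g x) (g x))).add
      ((h2.sub_const (∫ x in A, q x * (2 * inner ℝ (w x) (g x)))).const_mul (k / 2))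
    rwa [sub_self, sub_self, mul_zero, add_zero] at h3
  · have J1 : IntegrableOn (fun x => inner ℝ (g x) (G n x) - inner ℝ (g x) (g x)) A :=
      (I1 n).sub I2
    have J2 : IntegrableOn (fun x => k / 2 * (q x * (2 * inner ℝ (v n x) (G n x))
        - q x * (2 * inner ℝ (w x) (g x)))) A := ((I3 n).sub I4).const_mul _
    beta_reduce
    rw [← integral_sub (I1 n) I2, ← integral_sub (I3 n) I4, ← integral_const_mul,
      ← integral_const_mul, ← integral_add J1 J2, ← integral_add ((I5 n).const_mul _) I6,
      ← integral_add (((I5 n).const_mul _).fun_add I6) (J1.fun_add J2)]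
    refine integral_mono ((((I5 n).const_mul _).add I6).add (J1.add J2))
      (hW.pair n).integrable_kineticDensity.integrableOn fun x => ?_
    have e1 := norm_sub_sq_real (G n x) (g x)
    simp only [kineticDensity, q]
    rw [e1, real_inner_self_eq_norm_sq, real_inner_comm (G n x) (g x)]
    have : 0 ≤ k / 4 * (2 * inner ℝ (v n x) (G n x) - 2 * inner ℝ (w x) (g x)) ^ 2 := by positivity
    nlinarith

theorem tendsto_intervalIntegral (hW : WeakLimit v G w g B D) {f : ℂ → ℝ} (hf : Continuous f)
    (s t : ℝ) :
    Tendsto (fun n => ∫ x in s..t, f (v n x)) atTop (𝓝 (∫ x in s..t, f (w x))) := by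
  obtain ⟨C, hC⟩ := (isCompact_closedBall (0 : ℂ) B).exists_bound_of_continuousOn hf.continuousOn
  refine intervalIntegral.tendsto_integral_filter_of_dominated_convergence (fun _ => C)
    (Eventually.of_forall fun n => (hf.comp (hW.pair n).continuous).aestronglyMeasurable)
    (Eventually.of_forall fun n => Eventually.of_forall fun x _ => hC _ (by simpa using hW.bound n x))
    intervalIntegrable_const
    (Eventually.of_forall fun x _ => (hf.tendsto _).comp (hW.tendsto x))

end WeakLimit

end Limits

/-! ### Compactness of minimizing sequences and the minimizers. -/

section Compactness

/-! ### The weak limit of a minimizing sequence -/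

variable {k θ p lam : ℝ}

theorem actionDensity_eq (ν : ℝ) (a b : ℂ) :
    actionDensity k θ p ν a b = kineticDensity k a b - (θ / p * ‖a‖ ^ p + ν * ‖a‖ ^ 2) := by
  simp only [actionDensity, density, kineticDensity]
  ring

theorem H1Pair.integral_kineticDensity {u g : ℝ → ℂ} (hu : H1Pair u g) (hp : 2 ≤ p) :
    ∫ x, kineticDensity k (u x) (g x) = pairEnergy k θ p u g + θ / p * ∫ x, ‖u x‖ ^ p := by
  have h : ∀ x, density k θ p (u x) (g x)
      = kineticDensity k (u x) (g x) - θ / p * ‖u x‖ ^ p := fun x => rfl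
  simp only [pairEnergy, h]
  rw [integral_sub hu.integrable_kineticDensity ((hu.integrable_rpow hp).const_mul _),
    integral_const_mul, sub_add_cancel]

theorem integral_eq_add_three {f : ℝ → ℝ} (hf : Integrable f) (s t : ℝ) :
    ∫ x, f x = (∫ x in Set.Iic s, f x) + (∫ x in s..t, f x) + ∫ x in Set.Ioi t, f x := by
  rw [← intervalIntegral.integral_Iic_sub_Iic hf.integrableOn hf.integrableOn,
    ← intervalIntegral.integral_Iic_add_Ioi (b := t) hf.integrableOn hf.integrableOn]
  ring

namespace WeakLimit

variable {v G : ℕ → ℝ → ℂ} {w g : ℝ → ℂ} {B D : ℝ}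

/-- The kinetic part is lower semicontinuous, and the remaining terms converge on a bounded
interval. -/
theorem exists_action_ge (hW : WeakLimit v G w g B D) (hk : 0 ≤ k) (hp : 2 < p) (ν : ℝ) {s t : ℝ}
    (hst : s ≤ t) :
    ∃ e : ℕ → ℝ, Tendsto e atTop (𝓝 0) ∧ ∀ n,
      (∫ x in s..t, actionDensity k θ p ν (w x) (g x)) + e n
        ≤ ∫ x in s..t, actionDensity k θ p ν (v n x) (G n x) := by
  obtain ⟨e, he, hle⟩ := hW.exists_kinetic_ge hk (measurableSet_Ioc (a := s) (b := t))
  set F : ℂ → ℝ := fun a => θ / p * ‖a‖ ^ p + ν * ‖a‖ ^ 2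
  have hF : Continuous F := by
    refine (continuous_const.mul (continuous_norm.rpow_const fun _ => Or.inr (by linarith))).add ?_
    fun_prop
  have hsplit : ∀ {u h}, H1Pair u h → ∫ x in s..t, actionDensity k θ p ν (u x) (h x)
      = (∫ x in Set.Ioc s t, kineticDensity k (u x) (h x)) - ∫ x in s..t, F (u x) :=
    fun {u h} hu => by
      have hi : IntervalIntegrable (fun x => F (u x)) volume s t :=
        (hF.comp hu.continuous).intervalIntegrable _ _
      rw [← intervalIntegral.integral_of_le hst,
        ← intervalIntegral.integral_sub hu.integrable_kineticDensity.intervalIntegrable hi]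
      simp only [actionDensity_eq, F]
  refine ⟨fun n => e n - ((∫ x in s..t, F (v n x)) - ∫ x in s..t, F (w x)), ?_, fun n => ?_⟩
  · have h1 := he.sub ((hW.tendsto_intervalIntegral hF s t).sub_const (∫ x in s..t, F (w x)))
    rwa [sub_self, sub_zero] at h1
  · rw [hsplit hW.pair_limit, hsplit (hW.pair n)]
    have h1 : 0 ≤ ∫ x in Set.Ioc s t, ‖G n x - g x‖ ^ 2 := integral_nonneg fun _ => by positivity
    linarith [hle n]

theorem action_nonpos (hW : WeakLimit v G w g B D)
    (hb : BddBelow (energy k θ p '' massSphere lam)) (hk : 0 ≤ k) (hθ : 0 < θ)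
    (hlam : 0 < lam) (hp : 2 < p) (hneg : minEnergy k θ p lam ≤ 0)
    (hm : ∀ n, ∫ x, ‖v n x‖ ^ 2 = 2 * lam)
    (hE : Tendsto (fun n => pairEnergy k θ p (v n) (G n)) atTop (𝓝 (minEnergy k θ p lam)))
    (hpos : 0 < ∫ x, ‖w x‖ ^ 2) :
    ∫ x, actionDensity k θ p (minEnergy k θ p lam / (2 * lam)) (w x) (g x) ≤ 0 := by
  set ν := minEnergy k θ p lam / (2 * lam) with hν
  have hν0 : ν ≤ 0 := div_nonpos_of_nonpos_of_nonneg hneg (by positivity)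
  set A := 1 / 2 + k * B ^ 2 - ν with hA
  have hA0 : 0 ≤ A := by
    have : 0 ≤ k * B ^ 2 := by positivity
    linarith
  have hJlim : Tendsto (fun n => ∫ x, actionDensity k θ p ν (v n x) (G n x)) atTop (𝓝 0) := by
    have h1 := hE.sub_const (minEnergy k θ p lam)
    rw [sub_self] at h1
    refine h1.congr fun n => ?_
    rw [(hW.pair n).integral_actionDensity hp.le, hm n, hν]
    field_simp
  refine le_of_forall_pos_le_add fun ε hε => ?_
  set η := (∫ x, ‖w x‖ ^ 2) / 2 with hη
  -- The first bound keeps the boundary errors below `ε / 2`. The second keeps each outer piece,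
  -- with its exponential, within mass `2 * lam`, since more than `η` lies in `[-R, R]`.
  set ε' := min (ε / (2 * (A + 1))) η
  have hε' : 0 < ε' := lt_min (by positivity) (by positivity)
  have hin := intervalIntegral_tendsto_integral
    (hW.pair_limit.integrable_actionDensity (k := k) (θ := θ) hp.le ν) tendsto_neg_atTop_atBot
    tendsto_id
  have hin2 := intervalIntegral_tendsto_integral hW.pair_limit.integrable_sq
    tendsto_neg_atTop_atBot tendsto_id
  obtain ⟨R₀, hR₀⟩ := ((hin.eventually (lt_mem_nhds (sub_lt_self _ (half_pos hε)))).and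
    ((hin2.eventually (lt_mem_nhds (show η < _ by linarith))).and
      (eventually_ge_atTop 0))).exists_forall_of_atTop
  -- Adding the reflected function makes `w` small at `R` and `-R` simultaneously.
  obtain ⟨R, hRge, hR⟩ := exists_ge_lt_of_integrable
    (hW.pair_limit.integrable_sq.add hW.pair_limit.reflect.integrable_sq) hε' R₀
  obtain ⟨hJin, hMin, hR0⟩ := hR₀ R hRge
  simp only [id, Pi.add_apply] at hJin hMin hR
  obtain ⟨e, he, hle⟩ := hW.exists_action_ge (θ := θ) hk hp ν (s := -R) (t := R) (by linarith)
  have hev1 : ∀ᶠ n in atTop, ‖v n R‖ ^ 2 + ‖v n (-R)‖ ^ 2 < ε' :=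
    (((hW.tendsto R).norm.pow 2).add ((hW.tendsto (-R)).norm.pow 2)).eventually (gt_mem_nhds hR)
  have hev2 : ∀ᶠ n in atTop, η < ∫ x in (-R)..R, ‖v n x‖ ^ 2 :=
    (hW.tendsto_intervalIntegral (f := fun a => ‖a‖ ^ 2) (by fun_prop) (-R) R).eventually
      (lt_mem_nhds hMin)
  have hlow : ∀ᶠ n in atTop, (∫ x, actionDensity k θ p ν (w x) (g x)) - ε + e n
      ≤ ∫ x, actionDensity k θ p ν (v n x) (G n x) := by
    filter_upwards [hev1, hev2] with n h1 h2
    have hsq := integral_eq_add_three (hW.pair n).integrable_sq (-R) R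
    have hl : 0 ≤ ∫ x in Set.Iic (-R), ‖v n x‖ ^ 2 := integral_nonneg fun _ => by positivity
    have hr : 0 ≤ ∫ x in Set.Ioi R, ‖v n x‖ ^ 2 := integral_nonneg fun _ => by positivity
    have hεη : ε' ≤ η := min_le_right _ _
    have hs1 := sq_nonneg ‖v n R‖
    have hs2 := sq_nonneg ‖v n (-R)‖
    rw [hm n] at hsq
    have hright := action_Ioi_ge hb hk hθ hlam hp hneg (hW.pair n) (hW.bound n R)
      (by linarith)
    have hleft := action_Iic_ge hb hk hθ hlam hp hneg (hW.pair n) (hW.bound n (-R))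
      (by linarith)
    rw [← hν, ← hA] at hright hleft
    rw [integral_eq_add_three ((hW.pair n).integrable_actionDensity hp.le ν) (-R) R]
    have hAε : A * ε' ≤ ε / 2 := by
      calc A * ε' ≤ (A + 1) * (ε / (2 * (A + 1))) := by
            gcongr
            · linarith
            · exact min_le_left _ _
        _ = ε / 2 := by field_simp
    have hA1 : A * (‖v n R‖ ^ 2 + ‖v n (-R)‖ ^ 2) ≤ A * ε' := by gcongr
    have hA2 : 0 ≤ A * (‖v n R‖ ^ 2 + ‖v n (-R)‖ ^ 2) := by positivity
    linarith [hle n]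
  have := le_of_tendsto_of_tendsto (he.const_add _) hJlim hlow
  linarith

/-- If no mass is lost in the limit, the values converge in `L²`. -/
theorem tendsto_integral_sub_sq (hW : WeakLimit v G w g B D)
    (hm : ∀ n, ∫ x, ‖v n x‖ ^ 2 = ∫ x, ‖w x‖ ^ 2) :
    Tendsto (fun n => ∫ x, ‖v n x - w x‖ ^ 2) atTop (𝓝 0) := by
  have hw2 := hW.pair_limit.integrable_sq
  have h := tendsto_integral_of_tendsto_bounds (f := fun n x => ‖v n x - w x‖ ^ 2)
    (F := fun _ => 0) (G := fun n x => 2 * ‖v n x‖ ^ 2 + 2 * ‖w x‖ ^ 2)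
    (H := fun x => 2 * ‖w x‖ ^ 2 + 2 * ‖w x‖ ^ 2)
    (fun n => ((hW.pair n).sub hW.pair_limit).integrable_sq) (integrable_zero _ _ _)
    (fun n => ((hW.pair n).integrable_sq.const_mul 2).add (hw2.const_mul 2))
    ((hw2.const_mul 2).add (hw2.const_mul 2))
    (fun n x => by
      rw [abs_of_nonneg (by positivity)]
      have h1 := norm_sub_le (v n x) (w x)
      have h2 : ‖v n x - w x‖ ^ 2 ≤ (‖v n x‖ + ‖w x‖) ^ 2 := by gcongr
      nlinarith [sq_nonneg (‖v n x‖ - ‖w x‖)])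
    (fun x => by simpa using ((hW.tendsto x).sub_const (w x)).norm.pow 2)
    (fun x => (((hW.tendsto x).norm.pow 2).const_mul 2).add_const _)
    (by
      refine tendsto_const_nhds.congr fun n => ?_
      rw [integral_add ((hW.pair n).integrable_sq.const_mul 2) (hw2.const_mul 2),
        integral_add (hw2.const_mul 2) (hw2.const_mul 2), integral_const_mul, integral_const_mul,
        hm n])
  simpa using h

/-- The dominating functions `B ^ (p - 2) * |v_n|²` have constant integral, so the varying-bound
form of dominated convergence applies. -/
theorem tendsto_integral_rpow (hW : WeakLimit v G w g B D) (hp : 2 ≤ p)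
    (hm : ∀ n, ∫ x, ‖v n x‖ ^ 2 = ∫ x, ‖w x‖ ^ 2) :
    Tendsto (fun n => ∫ x, ‖v n x‖ ^ p) atTop (𝓝 (∫ x, ‖w x‖ ^ p)) := by
  refine tendsto_integral_of_tendsto_bounds (G := fun n x => B ^ (p - 2) * ‖v n x‖ ^ 2)
    (H := fun x => B ^ (p - 2) * ‖w x‖ ^ 2) (fun n => (hW.pair n).integrable_rpow hp)
    (hW.pair_limit.integrable_rpow hp) (fun n => (hW.pair n).integrable_sq.const_mul _)
    (hW.pair_limit.integrable_sq.const_mul _) (fun n x => ?_) (fun x => ?_) (fun x => ?_) ?_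
  · rw [abs_of_nonneg (by positivity)]
    exact H1Pair.rpow_le hp (norm_nonneg _) (hW.bound n x)
  · exact (hW.tendsto x).norm.rpow_const (Or.inr (by linarith))
  · exact ((hW.tendsto x).norm.pow 2).const_mul _
  · simp only [integral_const_mul, hm]
    exact tendsto_const_nhds

/-- Convergence of mass and energy implies convergence of the derivatives in `L²`. -/
theorem tendsto_integral_deriv_sub_sq (hW : WeakLimit v G w g B D) (hk : 0 ≤ k) (hp : 2 ≤ p)
    (hm : ∀ n, ∫ x, ‖v n x‖ ^ 2 = ∫ x, ‖w x‖ ^ 2)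
    (hE : Tendsto (fun n => pairEnergy k θ p (v n) (G n)) atTop (𝓝 (pairEnergy k θ p w g))) :
    Tendsto (fun n => ∫ x, ‖G n x - g x‖ ^ 2) atTop (𝓝 0) := by
  obtain ⟨e, he, hle⟩ := hW.exists_kinetic_ge hk MeasurableSet.univ
  simp only [Measure.restrict_univ] at hle
  -- Energy and potential converge, hence so does the kinetic part; then the surplus `½ ∫ ‖G n -
  -- g‖²` in `hle` must vanish.
  have hK : Tendsto (fun n => ∫ x, kineticDensity k (v n x) (G n x)) atTop
      (𝓝 (∫ x, kineticDensity k (w x) (g x))) := by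
    rw [hW.pair_limit.integral_kineticDensity (θ := θ) hp]
    refine (hE.add ((hW.tendsto_integral_rpow hp hm).const_mul (θ / p))).congr fun n => ?_
    rw [(hW.pair n).integral_kineticDensity (θ := θ) hp]
  have h1 := ((hK.sub_const (∫ x, kineticDensity k (w x) (g x))).sub he).const_mul 2
  rw [sub_self, sub_zero, mul_zero] at h1
  refine squeeze_zero (fun n => integral_nonneg fun _ => by positivity) (fun n => ?_) h1
  linarith [hle n]

end WeakLimit

/-! ### Compactness of minimizing sequences -/

theorem eventually_exists_norm_ge (hk : 0 ≤ k) (hθ : 0 < θ) (hlam : 0 < lam) (hp : 2 < p) {m : ℝ}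
    (hneg : m < 0) {v G : ℕ → ℝ → ℂ} (hv : ∀ n, H1Pair (v n) (G n))
    (hm : ∀ n, ∫ x, ‖v n x‖ ^ 2 = 2 * lam)
    (hE : Tendsto (fun n => pairEnergy k θ p (v n) (G n)) atTop (𝓝 m)) :
    ∃ δ > 0, ∀ᶠ n in atTop, ∃ x, δ ≤ ‖v n x‖ := by
  have hp0 : 0 < p := by linarith
  -- Chosen so that `θ / p * c * (2 * lam) = -m / 4`: a sup norm below `c ^ (1 / (p - 2))` would
  -- force energy at least `m / 4`, above `m / 2`.
  set c := -m * p / (8 * θ * lam) with hc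
  have hc0 : 0 < c := by
    have : 0 < -m := by linarith
    positivity
  refine ⟨c ^ (1 / (p - 2)), by positivity, ?_⟩
  filter_upwards [hE.eventually (gt_mem_nhds (show m < m / 2 by linarith))] with n hn
  by_contra! hcon
  have h1 := (hv n).integral_rpow_le hp.le fun x => (hcon x).le
  rw [← Real.rpow_mul hc0.le, one_div_mul_cancel (by linarith), Real.rpow_one, hm n] at h1
  have h2 : θ / p * ∫ x, ‖v n x‖ ^ p ≤ -m / 4 := by
    calc θ / p * ∫ x, ‖v n x‖ ^ p ≤ θ / p * (c * (2 * lam)) := by gcongr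
      _ = -m / 4 := by rw [hc]; field_simp; ring
  have h3 := H1Pair.kinetic_nonneg hk (v n) (G n)
  rw [(hv n).pairEnergy_eq hp.le] at hn
  linarith

theorem exists_minimizer_of_minimizing (hk : 0 ≤ k) (hθ : 0 < θ) (hlam : 0 < lam) (hp2 : 2 < p)
    (hp6 : p < 6) {v G : ℕ → ℝ → ℂ} (hv : ∀ n, H1Pair (v n) (G n))
    (hm : ∀ n, ∫ x, ‖v n x‖ ^ 2 = 2 * lam)
    (hE : Tendsto (fun n => pairEnergy k θ p (v n) (G n)) atTop (𝓝 (minEnergy k θ p lam))) :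
    ∃ (φ : ℕ → ℕ) (y : ℕ → ℝ) (w g : ℝ → ℂ), StrictMono φ ∧ H1Pair w g ∧
      ∫ x, ‖w x‖ ^ 2 = 2 * lam ∧ pairEnergy k θ p w g = minEnergy k θ p lam ∧
      Tendsto (fun n => ∫ x, ‖v (φ n) (x + y n) - w x‖ ^ 2) atTop (𝓝 0) ∧
      Tendsto (fun n => ∫ x, ‖G (φ n) (x + y n) - g x‖ ^ 2) atTop (𝓝 0) := by
  have hb := bddBelow_energy hk hθ hlam hp2 hp6
  have hneg := minEnergy_neg hb hθ hlam hp2 hp6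
  obtain ⟨C, hC⟩ := exists_coercive hk hθ hlam hp2 hp6
  obtain ⟨E₀, hE₀⟩ := hE.bddAbove_range
  have hD : ∀ n, ∫ x, ‖G n x‖ ^ 2 ≤ 4 * (E₀ + C) := fun n => by
    have h1 := hC _ _ (hv n) (hm n)
    have h2 := hE₀ ⟨n, rfl⟩
    simp only at h2
    linarith
  obtain ⟨δ, hδ, hev⟩ := eventually_exists_norm_ge hk hθ hlam hp2 hneg hv hm hE
  -- The lower bound is only eventual; where it fails the translation is set to 0.
  obtain ⟨y, hy⟩ : ∃ y : ℕ → ℝ, ∀ n, (∃ x, δ ≤ ‖v n x‖) → δ ≤ ‖v n (y n)‖ := by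
    have : ∀ n, ∃ y, (∃ x, δ ≤ ‖v n x‖) → δ ≤ ‖v n y‖ := fun n => by
      by_cases h : ∃ x, δ ≤ ‖v n x‖
      · exact ⟨h.choose, fun _ => h.choose_spec⟩
      · exact ⟨0, fun h' => absurd h' h⟩
    choose y hy using this
    exact ⟨y, hy⟩
  have hv' : ∀ n, H1Pair (fun x => v n (x + y n)) (fun x => G n (x + y n)) := fun n =>
    (hv n).translate (y n)
  have hm' : ∀ n, ∫ x, ‖v n (x + y n)‖ ^ 2 = 2 * lam := fun n => by
    rw [integral_add_right_eq_self (fun x => ‖v n x‖ ^ 2), hm n]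
  have hE' : ∀ n, pairEnergy k θ p (fun x => v n (x + y n)) (fun x => G n (x + y n))
      = pairEnergy k θ p (v n) (G n) := fun n =>
    integral_add_right_eq_self (fun x => density k θ p (v n x) (G n x)) (y n)
  obtain ⟨φ, w, g, B, hφ, hW, hwM⟩ := exists_weakLimit hv' (fun n => (hm' n).le) fun n => by
    rw [integral_add_right_eq_self (fun x => ‖G n x‖ ^ 2)]
    exact hD n
  have hEφ : Tendsto (fun n => pairEnergy k θ p (fun x => v (φ n) (x + y (φ n)))
      (fun x => G (φ n) (x + y (φ n)))) atTop (𝓝 (minEnergy k θ p lam)) := by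
    simp only [hE']
    exact hE.comp hφ.tendsto_atTop
  have hw0 : w 0 ≠ 0 := by
    rw [← norm_pos_iff]
    refine hδ.trans_le (ge_of_tendsto (hW.tendsto 0).norm ?_)
    filter_upwards [hφ.tendsto_atTop.eventually hev] with n hn
    simpa using hy (φ n) hn
  have hpos := hW.pair_limit.integral_sq_pos hw0
  have hJ := hW.action_nonpos hb hk hθ hlam hp2 hneg.le (fun n => hm' (φ n)) hEφ hpos
  have hDpos : 0 < ∫ x, ‖g x‖ ^ 2 := by
    by_contra! hle
    have h1 := hW.pair_limit.norm_sq_le 0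
    rw [Real.sqrt_eq_zero_of_nonpos hle, mul_zero, mul_zero] at h1
    exact hw0 (by simpa using h1)
  have hmass : ∫ x, ‖w x‖ ^ 2 = 2 * lam :=
    le_antisymm hwM (le_mass_of_action_nonpos hb hk hlam hp2 hW.pair_limit hpos hDpos hJ)
  have hEw : pairEnergy k θ p w g = minEnergy k θ p lam := by
    refine le_antisymm ?_ (minEnergy_le hb hW.pair_limit hmass)
    rw [hW.pair_limit.integral_actionDensity hp2.le, hmass,
      div_mul_cancel₀ _ (by positivity)] at hJ
    linarith
  have hmW : ∀ n, ∫ x, ‖v (φ n) (x + y (φ n))‖ ^ 2 = ∫ x, ‖w x‖ ^ 2 := fun n => by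
    rw [hm', hmass]
  rw [← hEw] at hEφ
  exact ⟨φ, fun n => y (φ n), w, g, hφ, hW.pair_limit, hmass, hEw,
    hW.tendsto_integral_sub_sq hmW, hW.tendsto_integral_deriv_sub_sq hk hp2.le hmW hEφ⟩

/-! ### Nonnegative minimizers -/

/-- The quasilinear and potential terms depend only on `|u|`, so they are unchanged, and `|u|` has
the smaller slope. -/
theorem H1Pair.exists_norm {u g : ℝ → ℂ} (hu : H1Pair u g) (hp : 2 ≤ p) :
    ∃ r : ℝ → ℂ, H1Pair (fun x => (‖u x‖ : ℂ)) r ∧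
      pairEnergy k θ p (fun x => (‖u x‖ : ℂ)) r ≤ pairEnergy k θ p u g := by
  obtain ⟨r, hr, hle⟩ := hu.isPrimitive.exists_norm
  have hpair : H1Pair (fun x => (‖u x‖ : ℂ)) (fun x => (r x : ℂ)) := by
    refine ⟨hu.memLp.norm.ofReal, ?_, fun a b => ?_⟩
    · exact (hu.memLp_deriv.mono hr.locallyIntegrable.aestronglyMeasurable hle).ofReal
    · rw [intervalIntegral.integral_ofReal, ← hr.sub_eq a b]
      push_cast
      rfl
  refine ⟨fun x => (r x : ℂ), hpair, ?_⟩
  have h1 := hpair.isPrimitive.norm_sq.isWeakDeriv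
  simp only [Complex.norm_real, norm_norm] at h1
  have hq := h1.ae_unique hu.isPrimitive.norm_sq.isWeakDeriv
  refine integral_mono_ae (hpair.integrable_density hp) (hu.integrable_density hp) ?_
  filter_upwards [hq, hle] with x hx hlex
  simp only [density]
  rw [hx]
  simp only [Complex.norm_real, norm_norm]
  gcongr

theorem exists_nonneg_minimizer (hk : 0 ≤ k) (hθ : 0 < θ) (hlam : 0 < lam) (hp2 : 2 < p)
    (hp6 : p < 6) :
    ∃ w : ℝ → ℝ, (∀ x, 0 ≤ w x) ∧ ¬ (w =ᵐ[volume] 0) ∧ (fun x => (w x : ℂ)) ∈ massSphere lam ∧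
      energy k θ p (fun x => (w x : ℂ)) = minEnergy k θ p lam := by
  have hb := bddBelow_energy hk hθ hlam hp2 hp6
  have hneg := minEnergy_neg hb hθ hlam hp2 hp6
  -- The infimum of the empty set is 0 by convention, which contradicts `m < 0`.
  have hne : (energy k θ p '' massSphere lam).Nonempty := by
    by_contra h
    rw [minEnergy, Set.not_nonempty_iff_eq_empty.mp h, Real.sInf_empty] at hneg
    exact lt_irrefl _ hneg
  obtain ⟨s, -, hs, hmem⟩ := exists_seq_tendsto_sInf hne hb
  choose u hu hus using hmem
  choose v G hv huv hm using fun n => exists_h1Pair_of_mem_massSphere (hu n)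
  obtain ⟨-, -, w, g, -, hw, hmass, hE, -⟩ := exists_minimizer_of_minimizing hk hθ hlam hp2 hp6 hv hm
    (hs.congr fun n => by rw [← hus n, (hv n).energy_eq (huv n)])
  obtain ⟨r, hr, hle⟩ := hw.exists_norm (k := k) (θ := θ) hp2.le
  have hmass' : ∫ x, ‖(‖w x‖ : ℂ)‖ ^ 2 = 2 * lam := by
    simpa only [Complex.norm_real, norm_norm] using hmass
  refine ⟨fun x => ‖w x‖, fun x => norm_nonneg _, fun h0 => ?_,
    hr.mem_massSphere (ae_eq_refl _) hmass', ?_⟩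
  · have : ∫ x, ‖w x‖ ^ 2 = 0 := integral_eq_zero_of_ae (h0.mono fun x hx => by
      simp only [Pi.zero_apply] at hx ⊢
      rw [hx]
      norm_num)
    linarith
  · rw [hr.energy_eq (ae_eq_refl _)]
    exact le_antisymm (hle.trans hE.le) (minEnergy_le hb hr hmass')

theorem exists_tendsto_h1Norm (hk : 0 ≤ k) (hθ : 0 < θ) (hlam : 0 < lam) (hp2 : 2 < p)
    (hp6 : p < 6) {u : ℕ → ℝ → ℂ} (hu : ∀ n, u n ∈ massSphere lam)
    (hE : Tendsto (fun n => energy k θ p (u n)) atTop (𝓝 (minEnergy k θ p lam))) :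
    ∃ (φ : ℕ → ℕ) (y : ℕ → ℝ) (w : ℝ → ℂ), StrictMono φ ∧ w ∈ massSphere lam ∧
      energy k θ p w = minEnergy k θ p lam ∧
      Tendsto (fun n => h1Norm (fun x => u (φ n) (x + y n) - w x)) atTop (𝓝 0) := by
  choose v G hv huv hm using fun n => exists_h1Pair_of_mem_massSphere (hu n)
  obtain ⟨φ, y, w, g, hφ, hw, hmass, hEw, hlim, hlim'⟩ :=
    exists_minimizer_of_minimizing hk hθ hlam hp2 hp6 hv hm
      (hE.congr fun n => (hv n).energy_eq (huv n))
  refine ⟨φ, y, w, hφ, hw.mem_massSphere (ae_eq_refl w) hmass,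
    (hw.energy_eq (ae_eq_refl w)).trans hEw, ?_⟩
  have hae : ∀ n, (fun x => u (φ n) (x + y n) - w x)
      =ᵐ[volume] fun x => v (φ n) (x + y n) - w x := fun n => by
    have := (measurePreserving_add_right volume (y n)).quasiMeasurePreserving.ae_eq_comp (huv (φ n))
    filter_upwards [this] with x hx
    simp only [Function.comp_apply] at hx
    rw [hx]
  have heq : ∀ n, h1Norm (fun x => u (φ n) (x + y n) - w x)
      = √((∫ x, ‖G (φ n) (x + y n) - g x‖ ^ 2) + ∫ x, ‖v (φ n) (x + y n) - w x‖ ^ 2) := fun n =>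
    (((hv (φ n)).translate (y n)).sub hw).h1Norm_eq (hae n)
  simp only [heq]
  simpa using (hlim'.add hlim).sqrt

end Compactness

end QuasilinearNLS

end

theorem proposition4p5 (k θ p lam : ℝ) (hk : 0 ≤ k) (hθ : 0 < θ) (hlam : 0 < lam)
    (hp4 : 4 ≤ p) (hp6 : p < 6) :
    -- the infimum `m` is finite and negative
    BddBelow (QuasilinearNLS.energy k θ p '' QuasilinearNLS.massSphere lam) ∧
    QuasilinearNLS.minEnergy k θ p lam < 0 ∧
    -- it is achieved by a nonzero nonnegative function
    (∃ w : ℝ → ℝ, (∀ x, 0 ≤ w x) ∧ ¬ (w =ᵐ[volume] 0) ∧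
      (fun x => (w x : ℂ)) ∈ QuasilinearNLS.massSphere lam ∧
      QuasilinearNLS.energy k θ p (fun x => (w x : ℂ)) = QuasilinearNLS.minEnergy k θ p lam) ∧
    -- up to a subsequence and translations, minimizing sequences converge in `H¹` to a minimizer
    (∀ u : ℕ → ℝ → ℂ, (∀ n, u n ∈ QuasilinearNLS.massSphere lam) →
      Tendsto (fun n => QuasilinearNLS.energy k θ p (u n)) atTop
        (𝓝 (QuasilinearNLS.minEnergy k θ p lam)) →
      ∃ (φ : ℕ → ℕ) (y : ℕ → ℝ) (w : ℝ → ℂ), StrictMono φ ∧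
        w ∈ QuasilinearNLS.massSphere lam ∧
        QuasilinearNLS.energy k θ p w = QuasilinearNLS.minEnergy k θ p lam ∧
        Tendsto (fun n => QuasilinearNLS.h1Norm (fun x => u (φ n) (x + y n) - w x)) atTop
          (𝓝 0)) := by
  have hp2 : 2 < p := by linarith
  have hb := QuasilinearNLS.bddBelow_energy hk hθ hlam hp2 hp6
  exact ⟨hb, QuasilinearNLS.minEnergy_neg hb hθ hlam hp2 hp6,
    QuasilinearNLS.exists_nonneg_minimizer hk hθ hlam hp2 hp6,
    fun _ hu hE => QuasilinearNLS.exists_tendsto_h1Norm hk hθ hlam hp2 hp6 hu hE⟩
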